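/- Let $dA$ be area measure on $\mathbb C$, let $d\lambda(z)=\frac1\pi e^{-|z|^2}\,dA(z)$, and let $F^2$ be the Fock space, that is, the Hilbert space of all entire functions $f$ with $\int_{\mathbb C}|f|^2\,d\lambda<\infty$, with inner product $\langle f,g\rangle=\int_{\mathbb C}f\,\overline g\,d\lambda$. For $s,t\in\mathbb C$ with $s\neq0$ consider the integral operator $$T^{(s,t)}f(z)=\int_{\mathbb C}K^{(s,t)}(z,w)f(w)\,d\lambda(w),\qquad K^{(s,t)}(z,w)=\frac1{\sqrt s}\exp\left[\frac{tz^2-\overline{tw^2}+2z\overline w}{2s}\right],$$ where $\sqrt s$ is the principal branch of the square root ($\sqrt s=\sqrt{|s|}\,e^{i\theta/2}$ for $s=|s|e^{i\theta}$ with $\theta\in(-\pi,\pi]$). For $p>0$, a compact operator $T$ on a Hilbert space belongs to the Schatten class $S_p$ if its singular values $\lambda_n$, i.e. the positive eigenvalues of $|T|=(T^*T)^{1/2}$ repeated according to multiplicity, satisfy $\sum_n\lambda_n^p<\infty$, and then $\|T\|_{S_p}=\left(\sum_n\lambda_n^p\right)^{1/p}$. **Theorem.** Suppose that $|s|^2>|t|^2+1$.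 Then, for every $f\in F^2$ and $z\in\mathbb C$, the integral defining $T^{(s,t)}f(z)$ converges absolutely, $T^{(s,t)}$ is a compact linear operator from $F^2$ to $F^2$, and it belongs to the Schatten class $S_p$ for every $p>0$. Moreover, $$\|T^{(s,t)}\|_{S_p}^p\le\frac{2|s|}{p\,(|s|^2-|t|^2-1)\,(|s|^2-|t|^2)^{(p-2)/4}},\qquad 0<p\le2,$$ and $$\|T^{(s,t)}\|_{S_p}^p\ge\frac{2|s|}{p\,(|s|^2-|t|^2-1)\,(|s|^2-|t|^2)^{(p-2)/4}},\qquad p\ge2.$$ -/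

import Mathlib

noncomputable section

namespace Fock

open MeasureTheory Set Filter
open scoped ENNReal NNReal Topology ComplexConjugate

/-- The Gaussian measure `dλ(z) = π⁻¹ exp(-|z|²) dA(z)` on the complex plane. -/
def gaussian : Measure ℂ :=
  (volume : Measure ℂ).withDensity
    (fun z => ENNReal.ofReal (Real.pi⁻¹ * Real.exp (-‖z‖ ^ 2)))

/-- The entire functions that are square integrable for the Gaussian measure. -/
def fockSubmodule : Submodule ℂ (ℂ → ℂ) where
  carrier := {f | Differentiable ℂ f ∧ MemLp f 2 gaussian}
  add_mem' hf hg := ⟨hf.1.add hg.1, hf.2.add hg.2⟩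
  zero_mem' := ⟨differentiable_const 0, MemLp.zero⟩
  smul_mem' c _ hf := ⟨hf.1.const_smul c, hf.2.const_smul c⟩

/-- The Fock space `F²`.  (A type synonym, so that it carries only the topology of its
inner product and not that of pointwise convergence.) -/
def FockSpace : Type := fockSubmodule

namespace FockSpace

instance : AddCommGroup FockSpace := inferInstanceAs (AddCommGroup fockSubmodule)

instance : Module ℂ FockSpace := inferInstanceAs (Module ℂ fockSubmodule)

/-- Elements of `F²` are functions on the complex plane. -/
instance : FunLike FockSpace ℂ ℂ where
  coe f := Subtype.val (p := fun g => g ∈ fockSubmodule) f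
  coe_injective _ _ h := Subtype.ext h

theorem ext {f g : FockSpace} (h : ∀ z, f z = g z) : f = g := DFunLike.ext f g h

/-- A square integrable entire function as an element of `F²`. -/
def mk (f : ℂ → ℂ) (hd : Differentiable ℂ f) (hm : MemLp f 2 gaussian) : FockSpace :=
  (⟨f, hd, hm⟩ : fockSubmodule)

@[simp] theorem mk_apply (f : ℂ → ℂ) (hd : Differentiable ℂ f) (hm : MemLp f 2 gaussian)
    (z : ℂ) : mk f hd hm z = f z := rfl

theorem differentiable (f : FockSpace) : Differentiable ℂ f := (Subtype.property f).1

theorem memLp (f : FockSpace) : MemLp f 2 gaussian := (Subtype.property f).2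

@[simp] theorem add_apply (f g : FockSpace) (z : ℂ) : (f + g) z = f z + g z := rfl

@[simp] theorem zero_apply (z : ℂ) : (0 : FockSpace) z = 0 := rfl

@[simp] theorem sub_apply (f g : FockSpace) (z : ℂ) : (f - g) z = f z - g z := rfl

@[simp] theorem smul_apply (c : ℂ) (f : FockSpace) (z : ℂ) : (c • f) z = c * f z := rfl

end FockSpace

theorem measurable_density :
    Measurable (fun z : ℂ => ENNReal.ofReal (Real.pi⁻¹ * Real.exp (-‖z‖ ^ 2))) := by
  fun_prop

theorem density_ne_zero (z : ℂ) :
    ENNReal.ofReal (Real.pi⁻¹ * Real.exp (-‖z‖ ^ 2)) ≠ 0 := by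
  have : 0 < Real.pi⁻¹ * Real.exp (-‖z‖ ^ 2) := by positivity
  simpa using this

theorem volume_absolutelyContinuous : (volume : Measure ℂ) ≪ gaussian :=
  withDensity_absolutelyContinuous' measurable_density.aemeasurable
    (Eventually.of_forall density_ne_zero)

instance : IsProbabilityMeasure gaussian where
  measure_univ := by
    have h1 : Integrable (fun z : ℂ => Real.pi⁻¹ * Real.exp (-‖z‖ ^ 2)) := by
      have := (GaussianFourier.integrable_cexp_neg_mul_sq_norm_add (V := ℂ) (b := 1) (by simp)
        0 0).norm
      refine (this.congr (Eventually.of_forall fun z => ?_)).const_mul _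
      simp [Complex.norm_exp, ← Complex.ofReal_pow]
    have h2 : ∫ z : ℂ, Real.pi⁻¹ * Real.exp (-‖z‖ ^ 2) = 1 := by
      have := GaussianFourier.integral_rexp_neg_mul_sq_norm (V := ℂ) (b := 1) one_pos
      rw [integral_const_mul]
      simp only [one_mul, neg_mul] at this
      rw [this]
      simp [Real.pi_ne_zero]
    rw [gaussian, withDensity_apply _ MeasurableSet.univ, Measure.restrict_univ,
      ← ofReal_integral_eq_lintegral_ofReal h1 (Eventually.of_forall fun z => by positivity), h2]
    simp

/-- The inner product `⟨f, g⟩ = ∫ f(z) conj(g(z)) dλ(z)` of `F²`.  Following Mathlib's convention,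
`inner ℂ f g` is conjugate-linear in `f`, so that the roles of the arguments are exchanged. -/
instance : Inner ℂ FockSpace := ⟨fun f g => ∫ z, g z * conj (f z) ∂gaussian⟩

theorem inner_def (f g : FockSpace) : inner ℂ f g = ∫ z, g z * conj (f z) ∂gaussian := rfl

theorem integrable_mul_conj (f g : FockSpace) :
    Integrable (fun z => g z * conj (f z)) gaussian :=
  g.memLp.integrable_mul f.memLp.star

theorem inner_self_eq (f : FockSpace) :
    (inner ℂ f f : ℂ) = ((∫ z, ‖f z‖ ^ 2 ∂gaussian : ℝ) : ℂ) := by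
  rw [inner_def, ← integral_complex_ofReal]
  congr 1
  funext z
  rw [Complex.mul_conj, Complex.normSq_eq_norm_sq]

/-- The inner product space structure of `F²`. -/
@[reducible]
def innerCore : InnerProductSpace.Core ℂ FockSpace where
  conj_inner_symm f g := by
    rw [inner_def, inner_def, ← integral_conj]
    congr 1
    funext z
    simp [mul_comm]
  re_inner_nonneg f := by
    rw [inner_self_eq]
    simp only [RCLike.re_to_complex, Complex.ofReal_re]
    positivity
  add_left f g h := by
    rw [inner_def, inner_def, inner_def, ← integral_add (integrable_mul_conj f h)
      (integrable_mul_conj g h)]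
    congr 1
    funext z
    simp [mul_add]
  smul_left f g c := by
    rw [inner_def, inner_def, ← integral_const_mul]
    congr 1
    funext z
    simp only [FockSpace.smul_apply, map_mul]
    ring
  definite f hf := by
    rw [inner_self_eq, Complex.ofReal_eq_zero,
      integral_eq_zero_iff_of_nonneg (fun z => by positivity) f.memLp.integrable_norm_pow'] at hf
    have h1 : (f : ℂ → ℂ) =ᵐ[volume] fun _ => 0 := by
      filter_upwards [volume_absolutelyContinuous.ae_le hf] with z hz
      simpa using hz
    have h2 := MeasureTheory.Measure.eq_of_ae_eq h1 f.differentiable.continuous continuous_const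
    exact FockSpace.ext fun z => congrFun h2 z

instance : NormedAddCommGroup FockSpace := innerCore.toNormedAddCommGroup

instance : InnerProductSpace ℂ FockSpace := InnerProductSpace.ofCore innerCore.toCore

/-- A mean value inequality over discs of radius one. -/
theorem enorm_le_lintegral_ball {f : ℂ → ℂ} (hf : Differentiable ℂ f) (c : ℂ) :
    ENNReal.ofReal Real.pi * ‖f c‖ₑ ≤ ∫⁻ w in Metric.ball c 1, ‖f w‖ₑ := by
  have hcont := hf.continuous
  have hcircle : ∀ r : ℝ, ENNReal.ofReal (2 * Real.pi) * ‖f c‖ₑ ≤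
      ∫⁻ θ in Ioo (-Real.pi) Real.pi, ‖f (circleMap c r θ)‖ₑ := by
    intro r
    have h1 : Real.circleAverage f c r = f c := hf.diffContOnCl.circleAverage
    rw [Real.circleAverage_eq_integral_add (-Real.pi),
      intervalIntegral.integral_comp_add_right (fun θ => f (circleMap c r θ)) (-Real.pi)] at h1
    have h2 : ∫ θ in (-Real.pi)..Real.pi, f (circleMap c r θ) = (2 * Real.pi : ℝ) • f c := by
      rw [← h1, smul_smul, mul_inv_cancel₀ (by positivity), one_smul]
      congr 1 <;> ring
    rw [intervalIntegral.integral_of_le (by linarith [Real.pi_pos]), integral_Ioc_eq_integral_Ioo]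
      at h2
    calc ENNReal.ofReal (2 * Real.pi) * ‖f c‖ₑ = ‖(2 * Real.pi : ℝ) • f c‖ₑ := by
          rw [enorm_smul, Real.enorm_of_nonneg (by positivity)]
      _ ≤ _ := by
          rw [← h2]
          exact enorm_integral_le_lintegral_enorm _
  have hsub : (Ioo (0 : ℝ) 1 ×ˢ Ioo (-Real.pi) Real.pi) ⊆ polarCoord.target :=
    prod_mono Ioo_subset_Ioi_self le_rfl
  have hcalc : ∫⁻ r in Ioo (0 : ℝ) 1, ENNReal.ofReal r * ENNReal.ofReal (2 * Real.pi) =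
      ENNReal.ofReal Real.pi := by
    rw [lintegral_mul_const _ (by fun_prop), ← ofReal_integral_eq_lintegral_ofReal,
      ← integral_Ioc_eq_integral_Ioo, ← intervalIntegral.integral_of_le zero_le_one, integral_id,
      ← ENNReal.ofReal_mul (by norm_num)]
    · congr 1
      ring
    · exact (continuous_id.integrableOn_Icc (a := (0 : ℝ)) (b := 1)).mono_set Ioo_subset_Icc_self
    · exact (ae_restrict_mem measurableSet_Ioo).mono fun r hr => hr.1.le
  have hmeas : Measurable fun p : ℝ × ℝ => ENNReal.ofReal p.1 * ‖f (circleMap c p.1 p.2)‖ₑ := by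
    have : Continuous fun p : ℝ × ℝ => f (circleMap c p.1 p.2) := by
      unfold circleMap
      fun_prop
    exact measurable_fst.ennreal_ofReal.mul this.measurable.enorm
  calc ENNReal.ofReal Real.pi * ‖f c‖ₑ
      = ∫⁻ r in Ioo (0 : ℝ) 1, ENNReal.ofReal r * (ENNReal.ofReal (2 * Real.pi) * ‖f c‖ₑ) := by
        simp_rw [← mul_assoc]
        rw [lintegral_mul_const _ (by fun_prop), hcalc]
    _ ≤ ∫⁻ r in Ioo (0 : ℝ) 1, ∫⁻ θ in Ioo (-Real.pi) Real.pi,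
          ENNReal.ofReal r * ‖f (circleMap c r θ)‖ₑ := by
        refine lintegral_mono fun r => ?_
        simp only
        rw [lintegral_const_mul' _ _ ENNReal.ofReal_ne_top]
        gcongr
        exact hcircle r
    _ = ∫⁻ p in Ioo (0 : ℝ) 1 ×ˢ Ioo (-Real.pi) Real.pi,
          ENNReal.ofReal p.1 * ‖f (circleMap c p.1 p.2)‖ₑ := by
        rw [Measure.volume_eq_prod, ← Measure.prod_restrict, lintegral_prod _ hmeas.aemeasurable]
    _ = ∫⁻ p in Ioo (0 : ℝ) 1 ×ˢ Ioo (-Real.pi) Real.pi, ENNReal.ofReal p.1 •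
          (Metric.ball c 1).indicator (fun w => ‖f w‖ₑ) (Complex.polarCoord.symm p + c) := by
        refine setLIntegral_congr_fun (measurableSet_Ioo.prod measurableSet_Ioo) fun p hp => ?_
        have hc : Complex.polarCoord.symm p + c = circleMap c p.1 p.2 := by
          rw [Complex.polarCoord_symm_apply, circleMap, Complex.exp_mul_I]
          push_cast
          ring
        have hb : circleMap c p.1 p.2 ∈ Metric.ball c 1 := by
          rw [Metric.mem_ball, dist_eq_norm, circleMap_sub_center, norm_circleMap_zero,
            abs_of_pos hp.1.1]
          exact hp.1.2
        simp only [hc, indicator_of_mem hb, smul_eq_mul]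
    _ ≤ ∫⁻ p in polarCoord.target, ENNReal.ofReal p.1 •
          (Metric.ball c 1).indicator (fun w => ‖f w‖ₑ) (Complex.polarCoord.symm p + c) :=
        lintegral_mono_set hsub
    _ = ∫⁻ w in Metric.ball c 1, ‖f w‖ₑ := by
        rw [Complex.lintegral_comp_polarCoord_symm
          (fun w => (Metric.ball c 1).indicator (fun w => ‖f w‖ₑ) (w + c)),
          lintegral_add_right_eq_self (fun w => (Metric.ball c 1).indicator (fun w => ‖f w‖ₑ) w) c,
          lintegral_indicator Metric.isOpen_ball.measurableSet]

namespace FockSpace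

theorem norm_sq_eq (f : FockSpace) : ‖f‖ ^ 2 = ∫ z, ‖f z‖ ^ 2 ∂gaussian := by
  rw [@norm_sq_eq_re_inner ℂ, inner_self_eq]
  simp

theorem norm_eq_norm_toLp (f : FockSpace) : ‖f‖ = ‖f.memLp.toLp‖ := by
  have h : ‖f.memLp.toLp‖ ^ 2 = ‖f‖ ^ 2 := by
    have h1 : (inner ℂ f.memLp.toLp f.memLp.toLp : ℂ) = inner ℂ f f := by
      rw [L2.inner_def, inner_def]
      refine integral_congr_ae ?_
      filter_upwards [f.memLp.coeFn_toLp] with z hz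
      rw [hz]
      rfl
    rw [@norm_sq_eq_re_inner ℂ, h1, ← @norm_sq_eq_re_inner ℂ]
  exact ((sq_eq_sq₀ (norm_nonneg _) (norm_nonneg _)).1 h).symm

/-- Point evaluations are bounded, locally uniformly. -/
theorem exists_norm_apply_le (R : ℝ) :
    ∃ C : ℝ, 0 ≤ C ∧ ∀ (f : FockSpace) (z : ℂ), ‖z‖ ≤ R → ‖f z‖ ≤ C * ‖f‖ := by
  refine ⟨Real.exp ((R + 1) ^ 2), by positivity, fun f z hz => ?_⟩
  have hR : 0 ≤ R := (norm_nonneg z).trans hz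
  set ρ : ℂ → ℝ≥0∞ := fun w => ENNReal.ofReal (Real.pi⁻¹ * Real.exp (-‖w‖ ^ 2)) with hρ
  set E : ℝ≥0∞ := ENNReal.ofReal (Real.pi * Real.exp ((R + 1) ^ 2)) with hE
  have hmeas : Measurable fun w => ‖f w‖ₑ := f.differentiable.continuous.measurable.enorm
  have h1 : ∫⁻ w in Metric.ball z 1, ‖f w‖ₑ ≤ E * ∫⁻ w, ‖f w‖ₑ ∂gaussian := by
    rw [gaussian, lintegral_withDensity_eq_lintegral_mul _ measurable_density hmeas,
      ← lintegral_const_mul _ (measurable_density.mul hmeas)]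
    refine (setLIntegral_mono' Metric.isOpen_ball.measurableSet fun w hw => ?_).trans
      (setLIntegral_le_lintegral (Metric.ball z 1) _)
    have hw' : ‖w‖ ≤ R + 1 := by
      have : ‖w - z‖ < 1 := by simpa [dist_eq_norm] using hw
      linarith [norm_le_norm_add_norm_sub' w z]
    have h2 : 1 ≤ E * ρ w := by
      rw [hE, hρ, ← ENNReal.ofReal_mul (by positivity), ENNReal.one_le_ofReal]
      have : Real.pi * Real.exp ((R + 1) ^ 2) * (Real.pi⁻¹ * Real.exp (-‖w‖ ^ 2)) =
          Real.exp ((R + 1) ^ 2 - ‖w‖ ^ 2) := by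
        rw [sub_eq_add_neg, Real.exp_add]
        field_simp
      rw [this, Real.one_le_exp_iff]
      nlinarith [norm_nonneg w]
    calc ‖f w‖ₑ = 1 * ‖f w‖ₑ := (one_mul _).symm
      _ ≤ E * ρ w * ‖f w‖ₑ := by gcongr
      _ = _ := mul_assoc _ _ _
  have h3 : ∫⁻ w, ‖f w‖ₑ ∂gaussian ≤ ‖f‖ₑ := by
    rw [← eLpNorm_one_eq_lintegral_enorm, ← ofReal_norm, norm_eq_norm_toLp, Lp.norm_toLp,
      ENNReal.ofReal_toReal f.memLp.eLpNorm_ne_top]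
    exact eLpNorm_le_eLpNorm_of_exponent_le (by norm_num) f.memLp.aestronglyMeasurable
  have h4 : ENNReal.ofReal (Real.pi * ‖f z‖) ≤
      ENNReal.ofReal (Real.pi * (Real.exp ((R + 1) ^ 2) * ‖f‖)) := by
    rw [← mul_assoc, ENNReal.ofReal_mul (by positivity), ENNReal.ofReal_mul (by positivity),
      ofReal_norm, ofReal_norm]
    exact (enorm_le_lintegral_ball f.differentiable z).trans (h1.trans (by gcongr))
  rw [ENNReal.ofReal_le_ofReal_iff (by positivity)] at h4
  exact le_of_mul_le_mul_left h4 Real.pi_pos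

end FockSpace

/-- `F²` is a Hilbert space. -/
instance : CompleteSpace FockSpace := by
  refine Metric.complete_of_cauchySeq_tendsto fun u hu => ?_
  -- the limit in `L²`
  have hLp : CauchySeq fun n => (u n).memLp.toLp := by
    rw [Metric.cauchySeq_iff] at hu ⊢
    intro ε hε
    obtain ⟨N, hN⟩ := hu ε hε
    refine ⟨N, fun m hm n hn => ?_⟩
    have := hN m hm n hn
    rw [dist_eq_norm, FockSpace.norm_eq_norm_toLp] at this
    rw [dist_eq_norm]
    exact this
  obtain ⟨g, hg⟩ := cauchySeq_tendsto_of_complete hLp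
  -- the locally uniform limit
  have hunif : ∀ R : ℝ, UniformCauchySeqOn (fun n => (u n : ℂ → ℂ)) atTop
      (Metric.closedBall 0 R) := by
    intro R
    obtain ⟨C, hC, hCb⟩ := FockSpace.exists_norm_apply_le R
    rw [Metric.uniformCauchySeqOn_iff]
    rw [Metric.cauchySeq_iff] at hu
    intro ε hε
    obtain ⟨N, hN⟩ := hu (ε / (C + 1)) (by positivity)
    refine ⟨N, fun m hm n hn z hz => ?_⟩
    have h1 := hCb (u m - u n) z (by simpa using hz)
    have h2 := hN m hm n hn
    rw [dist_eq_norm] at h2 ⊢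
    rw [lt_div_iff₀ (by positivity)] at h2
    rw [FockSpace.sub_apply] at h1
    nlinarith [norm_nonneg (u m - u n)]
  have hpt : ∀ z, ∃ a, Tendsto (fun n => u n z) atTop (𝓝 a) := fun z =>
    cauchySeq_tendsto_of_complete ((hunif ‖z‖).cauchySeq (by simp))
  choose F hF using hpt
  have hloc : TendstoLocallyUniformlyOn (fun n => (u n : ℂ → ℂ)) F atTop univ := by
    rw [tendstoLocallyUniformlyOn_iff_forall_isCompact isOpen_univ]
    intro K _ hK
    obtain ⟨R, hR⟩ := hK.isBounded.subset_closedBall 0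
    exact ((hunif R).tendstoUniformlyOn_of_tendsto fun z _ => hF z).mono hR
  have hdiff : Differentiable ℂ F := by
    rw [← differentiableOn_univ]
    exact hloc.differentiableOn
      (Eventually.of_forall fun n => (u n).differentiable.differentiableOn) isOpen_univ
  have hFg : F =ᵐ[gaussian] g := by
    obtain ⟨ns, hns, hae⟩ := (tendstoInMeasure_of_tendsto_Lp hg).exists_seq_tendsto_ae
    have hall : ∀ᵐ z ∂gaussian, ∀ n, ((u n).memLp.toLp : ℂ → ℂ) z = u n z :=
      ae_all_iff.2 fun n => (u n).memLp.coeFn_toLp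
    filter_upwards [hae, hall] with z hz1 hz2
    simp only [hz2] at hz1
    exact tendsto_nhds_unique ((hF z).comp hns.tendsto_atTop) hz1
  have hFm : MemLp F 2 gaussian := (memLp_congr_ae hFg).2 (Lp.memLp g)
  let G : FockSpace := FockSpace.mk F hdiff hFm
  refine ⟨G, ?_⟩
  have hGg : G.memLp.toLp = g := by
    refine Lp.ext ?_
    filter_upwards [G.memLp.coeFn_toLp, hFg] with z h1 h2
    rw [h1, ← h2, FockSpace.mk_apply]
  rw [tendsto_iff_norm_sub_tendsto_zero] at hg ⊢
  refine hg.congr fun n => ?_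
  rw [FockSpace.norm_eq_norm_toLp, ← hGg]
  rfl

/-- The canonical integral kernel `K^{(s,t)}(z,w)`, with the principal branch of `√s`. -/
def canonicalKernel (s t z w : ℂ) : ℂ :=
  1 / Complex.sqrt s *
    Complex.exp ((t * z ^ 2 - conj (t * w ^ 2) + 2 * z * conj w) / (2 * s))

/-- The bounded operator `T` on `F²` is the canonical integral operator `T^{(s,t)}`:
`T f(z) = ∫ K^{(s,t)}(z,w) f(w) dλ(w)` for all `f` in `F²` and all `z`, the integral being
absolutely convergent. -/
def IsCanonicalOperator (s t : ℂ) (T : FockSpace →L[ℂ] FockSpace) : Prop :=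
  ∀ (f : FockSpace) (z : ℂ),
    Integrable (fun w => canonicalKernel s t z w * f w) gaussian ∧
      T f z = ∫ w, canonicalKernel s t z w * f w ∂gaussian

section Schatten

/-- The number of times that `σ` occurs among the singular values of `T`: its multiplicity as
an eigenvalue of `|T| = (T* T)^{1/2}`. -/
def singularMultiplicity {H : Type*} [NormedAddCommGroup H] [InnerProductSpace ℂ H]
    [CompleteSpace H] (T : H →L[ℂ] H) (σ : ℝ) : ℕ :=
  Module.finrank ℂ (Module.End.eigenspace (CFC.abs T : H →L[ℂ] H).toLinearMap (σ : ℂ))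

/-- `∑ λₙᵖ` over the positive singular values `λₙ` of a compact operator `T`, repeated according
to multiplicity. -/
def schattenSum {H : Type*} [NormedAddCommGroup H] [InnerProductSpace ℂ H]
    [CompleteSpace H] (p : ℝ) (T : H →L[ℂ] H) : ℝ≥0∞ :=
  ∑' σ : Ioi (0 : ℝ), (singularMultiplicity T σ : ℝ≥0∞) * ENNReal.ofReal ((σ : ℝ) ^ p)

/-- Membership of `T` in the Schatten class `S_p`. -/
def MemSchatten {H : Type*} [NormedAddCommGroup H] [InnerProductSpace ℂ H]
    [CompleteSpace H] (p : ℝ) (T : H →L[ℂ] H) : Prop :=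
  IsCompactOperator T ∧ schattenSum p T < ∞

/-- The Schatten norm `‖T‖_{S_p} = (∑ λₙᵖ)^{1/p}` of an operator `T` in `S_p`. -/
def schattenNorm {H : Type*} [NormedAddCommGroup H] [InnerProductSpace ℂ H]
    [CompleteSpace H] (p : ℝ) (T : H →L[ℂ] H) : ℝ :=
  (schattenSum p T).toReal ^ (1 / p)

end Schatten

end Fock

end

noncomputable section

namespace Fock

open MeasureTheory Set Filter
open scoped ENNReal NNReal Topology ComplexConjugate

/-! The singular values can be computed exactly. Both `T` and `T*` map Gaussian exponentials `exp (α
z² / 2 + β z)` to multiples of such functions. For one special `α`, built from the positive root `R`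
of `R² - (|s|² - |t|² - 1) R = |s|²`, the composition `T* T` returns to the same `α` and only
rescales `β` by `|s|² / R²`, up to a scalar factor. A factor `exp (δ β²)` makes that scalar
constant, giving an entire `F²`-valued map `G` with `T* T G(β) = c G(|s|² β / R²)`
(`exists_adjoint_comp_eigenGen`).

Taylor coefficients of `G` at `0` are therefore eigenvectors, with eigenvalues `c (|s|² / R²)ⁿ`.
They are nonzero by a generating function for inner products (`exists_inner_eigenGen`) and complete
because the exponentials with fixed `α` span a dense subspace (`eq_zero_of_inner_expVec`).
Positivity of `T* T` forces `c = |s| / R`.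

With `m = R / |s| > 1` the singular values are `m ^ (-(n + 1/2))`, all simple. This gives
compactness, and `∑ λₙᵖ` is a geometric series; Bernoulli's inequality together with `m² ≤ |s|² -
|t|²` compares its sum with the stated bound, in opposite directions for `p ≤ 2` and `p ≥ 2`. -/

/-! ### Gaussian integrals and growth criteria for `F²` -/

theorem toReal_density (z : ℂ) :
    (ENNReal.ofReal (Real.pi⁻¹ * Real.exp (-‖z‖ ^ 2))).toReal =
      Real.pi⁻¹ * Real.exp (-‖z‖ ^ 2) :=
  ENNReal.toReal_ofReal (by positivity)

theorem integral_gaussian {E : Type*} [NormedAddCommGroup E] [NormedSpace ℝ E] (f : ℂ → E) :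
    ∫ z, f z ∂gaussian = ∫ z : ℂ, (Real.pi⁻¹ * Real.exp (-‖z‖ ^ 2)) • f z := by
  rw [gaussian, integral_withDensity_eq_integral_toReal_smul measurable_density
    (Eventually.of_forall fun _ => ENNReal.ofReal_lt_top)]
  simp_rw [toReal_density]

theorem integrable_gaussian_iff {E : Type*} [NormedAddCommGroup E] [NormedSpace ℝ E]
    {f : ℂ → E} :
    Integrable f gaussian ↔
      Integrable (fun z : ℂ => (Real.pi⁻¹ * Real.exp (-‖z‖ ^ 2)) • f z) := by
  rw [gaussian, integrable_withDensity_iff_integrable_smul' measurable_density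
    (Eventually.of_forall fun _ => ENNReal.ofReal_lt_top)]
  simp_rw [toReal_density]

theorem integrable_exp_mul_normSq {ρ : ℝ} (hρ : ρ < 1) :
    Integrable (fun z : ℂ => Real.exp (ρ * ‖z‖ ^ 2)) gaussian := by
  rw [integrable_gaussian_iff]
  have := (GaussianFourier.integrable_cexp_neg_mul_sq_norm_add (V := ℂ) (b := (1 - ρ : ℝ))
    (by simpa using hρ) 0 0).norm.const_mul Real.pi⁻¹
  refine this.congr (Eventually.of_forall fun z => ?_)
  simp only [zero_mul, add_zero, Complex.norm_exp, smul_eq_mul, mul_assoc, ← Real.exp_add]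
  congr 2
  rw [← Complex.ofReal_neg, ← Complex.ofReal_pow, ← Complex.ofReal_mul, Complex.ofReal_re]
  ring

/-- The norm of `exp (ρ |z|² / 2)` in `L²` of the Gaussian measure. -/
def growthConst (ρ : ℝ) : ℝ := √(∫ z : ℂ, Real.exp (ρ * ‖z‖ ^ 2) ∂gaussian)

theorem growthConst_nonneg (ρ : ℝ) : 0 ≤ growthConst ρ := Real.sqrt_nonneg _

theorem sq_growthConst (ρ : ℝ) :
    growthConst ρ ^ 2 = ∫ z : ℂ, Real.exp (ρ * ‖z‖ ^ 2) ∂gaussian :=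
  Real.sq_sqrt (integral_nonneg fun _ => by positivity)

theorem sq_growth (C ρ x : ℝ) :
    (C * Real.exp (ρ * x ^ 2 / 2)) ^ 2 = C ^ 2 * Real.exp (ρ * x ^ 2) := by
  rw [mul_pow, ← Real.exp_nat_mul]
  congr 2
  push_cast
  ring

theorem memLp_of_growth {f : ℂ → ℂ} (hf : Continuous f) {C ρ : ℝ} (hρ : ρ < 1)
    (h : ∀ z, ‖f z‖ ≤ C * Real.exp (ρ * ‖z‖ ^ 2 / 2)) : MemLp f 2 gaussian := by
  rw [memLp_two_iff_integrable_sq_norm hf.aestronglyMeasurable]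
  refine ((integrable_exp_mul_normSq hρ).const_mul (C ^ 2)).mono'
    (hf.norm.pow 2).aestronglyMeasurable (Eventually.of_forall fun z => ?_)
  rw [Real.norm_of_nonneg (by positivity), ← sq_growth]
  exact pow_le_pow_left₀ (norm_nonneg _) (h z) 2

theorem FockSpace.norm_le_of_growth (f : FockSpace) {C ρ : ℝ} (hC : 0 ≤ C) (hρ : ρ < 1)
    (h : ∀ z, ‖f z‖ ≤ C * Real.exp (ρ * ‖z‖ ^ 2 / 2)) : ‖f‖ ≤ C * growthConst ρ := by
  refine le_of_sq_le_sq ?_ (mul_nonneg hC (growthConst_nonneg ρ))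
  rw [FockSpace.norm_sq_eq, mul_pow, sq_growthConst, ← integral_const_mul]
  refine integral_mono_of_nonneg (Eventually.of_forall fun _ => by positivity)
    ((integrable_exp_mul_normSq hρ).const_mul (C ^ 2)) (Eventually.of_forall fun z => ?_)
  simp only
  rw [← sq_growth]
  exact pow_le_pow_left₀ (norm_nonneg _) (h z) 2

/-! ### Gaussian exponentials as a holomorphic family of vectors -/

/-- By AM-GM, half of the gap `1 - a` absorbs the linear term; the new rate `(1 + a) / 2` is still
below `1`, so the bound remains square integrable. -/
theorem exp_quadratic_le {a : ℝ} (ha : a < 1) (k r : ℝ) :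
    Real.exp (a * r ^ 2 / 2 + k * r) ≤
      Real.exp (k ^ 2 / (1 - a)) * Real.exp ((1 + a) / 2 * r ^ 2 / 2) := by
  rw [← Real.exp_add, Real.exp_le_exp]
  have h : 0 < 1 - a := by linarith
  have h2 : k * r ≤ k ^ 2 / (1 - a) + (1 - a) / 4 * r ^ 2 := by
    have : k ^ 2 / (1 - a) + (1 - a) / 4 * r ^ 2 - k * r =
        (k - (1 - a) / 2 * r) ^ 2 / (1 - a) := by
      field_simp
      ring
    have : 0 ≤ (k - (1 - a) / 2 * r) ^ 2 / (1 - a) := by positivity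
    linarith
  linarith

theorem norm_exp_quadratic_le (α β z : ℂ) :
    ‖Complex.exp (α * z ^ 2 / 2 + β * z)‖ ≤
      Real.exp (‖α‖ * ‖z‖ ^ 2 / 2 + ‖β‖ * ‖z‖) := by
  rw [Complex.norm_exp, Real.exp_le_exp]
  refine (Complex.re_le_norm _).trans ((norm_add_le _ _).trans (le_of_eq ?_))
  simp

/-- The function `exp (α z² / 2 + β z)` as an element of `F²`, for `|α| < 1`. -/
def expVec (α : ℂ) (hα : ‖α‖ < 1) (β : ℂ) : FockSpace :=
  FockSpace.mk (fun z => Complex.exp (α * z ^ 2 / 2 + β * z)) (by fun_prop)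
    (memLp_of_growth (by fun_prop) (ρ := (1 + ‖α‖) / 2) (by linarith)
      fun z => (norm_exp_quadratic_le α β z).trans (exp_quadratic_le hα ‖β‖ ‖z‖))

@[simp] theorem expVec_apply (α : ℂ) (hα : ‖α‖ < 1) (β z : ℂ) :
    expVec α hα β z = Complex.exp (α * z ^ 2 / 2 + β * z) := rfl

theorem norm_le_two_exp (r : ℝ) (hr : 0 ≤ r) : r ≤ 2 * Real.exp (2 * r) := by
  have h := Real.add_one_le_exp (2 * r)
  linarith

theorem sq_le_two_exp (r : ℝ) (hr : 0 ≤ r) : r ^ 2 ≤ 2 * Real.exp r := by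
  have h := Real.quadratic_le_exp_of_nonneg hr
  linarith

/-- The derivative of `β ↦ expVec α hα β`. -/
def expVecDeriv (α : ℂ) (hα : ‖α‖ < 1) (β : ℂ) : FockSpace :=
  FockSpace.mk (fun z => z * Complex.exp (α * z ^ 2 / 2 + β * z)) (by fun_prop)
    (memLp_of_growth (C := 2 * Real.exp ((‖β‖ + 2) ^ 2 / (1 - ‖α‖))) (by fun_prop)
      (ρ := (1 + ‖α‖) / 2) (by linarith) fun z => by
        have h1 := norm_exp_quadratic_le α β z
        -- The factor `‖z‖` is bounded by `2 exp (2 ‖z‖)`, which shifts `‖β‖` by `2`.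
        have h2 := exp_quadratic_le hα (‖β‖ + 2) ‖z‖
        have h3 := norm_le_two_exp ‖z‖ (norm_nonneg z)
        rw [norm_mul, mul_assoc]
        calc _ ≤ (2 * Real.exp (2 * ‖z‖)) * Real.exp (‖α‖ * ‖z‖ ^ 2 / 2 + ‖β‖ * ‖z‖) := by
              gcongr
          _ = 2 * Real.exp (‖α‖ * ‖z‖ ^ 2 / 2 + (‖β‖ + 2) * ‖z‖) := by
              rw [mul_assoc, ← Real.exp_add]
              congr 2
              ring
          _ ≤ _ := by gcongr)

/-- Differentiability holds in the norm of `F²`, so Taylor coefficients in `β` are vectors of `F²`.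
The second-order remainder of `exp (h z)` is `O(|h|²)` times a function of admissible growth. -/
theorem hasDerivAt_expVec (α : ℂ) (hα : ‖α‖ < 1) (β : ℂ) :
    HasDerivAt (expVec α hα) (expVecDeriv α hα β) β := by
  rw [hasDerivAt_iff_isLittleO_nhds_zero]
  set C : ℝ := 2 * Real.exp ((‖β‖ + 2) ^ 2 / (1 - ‖α‖)) with hC
  have key : ∀ h : ℂ, ‖h‖ ≤ 1 →
      ‖expVec α hα (β + h) - expVec α hα β - h • expVecDeriv α hα β‖ ≤
        (‖h‖ ^ 2 * C) * growthConst ((1 + ‖α‖) / 2) := by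
    intro h hh
    refine FockSpace.norm_le_of_growth _ (by positivity) (by linarith) fun z => ?_
    have e1 : (expVec α hα (β + h) - expVec α hα β - h • expVecDeriv α hα β) z =
        Complex.exp (α * z ^ 2 / 2 + β * z) *
          (Complex.exp (h * z) - ∑ m ∈ Finset.range 2, (h * z) ^ m / m.factorial) := by
      simp only [FockSpace.sub_apply, FockSpace.smul_apply, expVec_apply, expVecDeriv,
        FockSpace.mk_apply, Finset.sum_range_succ, Finset.sum_range_zero]
      rw [show α * z ^ 2 / 2 + (β + h) * z = (α * z ^ 2 / 2 + β * z) + h * z by ring,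
        Complex.exp_add (α * z ^ 2 / 2 + β * z)]
      simp
      ring
    have h1 := norm_exp_quadratic_le α β z
    have h2 := exp_quadratic_le hα (‖β‖ + 2) ‖z‖
    have h3 := sq_le_two_exp ‖z‖ (norm_nonneg z)
    have h4 := Complex.norm_exp_sub_sum_le_norm_mul_exp (h * z) 2
    have h5 : Real.exp ‖h * z‖ ≤ Real.exp ‖z‖ := by
      rw [Real.exp_le_exp, norm_mul]
      exact mul_le_of_le_one_left (norm_nonneg z) hh
    rw [e1, norm_mul]
    calc _ ≤ Real.exp (‖α‖ * ‖z‖ ^ 2 / 2 + ‖β‖ * ‖z‖) *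
          ((‖h‖ ^ 2 * (2 * Real.exp ‖z‖)) * Real.exp ‖z‖) := by
          gcongr
          refine h4.trans ?_
          rw [norm_mul, mul_pow]
          rw [norm_mul] at h5
          gcongr
      -- One factor `exp ‖z‖` comes from `‖z‖² ≤ 2 exp ‖z‖`, the other from `exp ‖h z‖` with `‖h‖ ≤
      -- 1`; together they give the shift by `2`.
      _ = ‖h‖ ^ 2 * (2 * Real.exp (‖α‖ * ‖z‖ ^ 2 / 2 + (‖β‖ + 2) * ‖z‖)) := by
          rw [show ‖α‖ * ‖z‖ ^ 2 / 2 + (‖β‖ + 2) * ‖z‖ =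
            (‖α‖ * ‖z‖ ^ 2 / 2 + ‖β‖ * ‖z‖) + ‖z‖ + ‖z‖ by ring, Real.exp_add _ ‖z‖,
            Real.exp_add _ ‖z‖]
          ring
      _ ≤ ‖h‖ ^ 2 * (2 * (Real.exp ((‖β‖ + 2) ^ 2 / (1 - ‖α‖)) *
            Real.exp ((1 + ‖α‖) / 2 * ‖z‖ ^ 2 / 2))) := by gcongr
      _ = _ := by
          rw [hC]
          ring
  have hO : (fun h : ℂ => expVec α hα (β + h) - expVec α hα β - h • expVecDeriv α hα β)
      =O[𝓝 0] fun h : ℂ => ‖h‖ ^ 2 := by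
    refine Asymptotics.IsBigO.of_bound (C * growthConst ((1 + ‖α‖) / 2)) ?_
    filter_upwards [Metric.closedBall_mem_nhds (0 : ℂ) one_pos] with h hh
    rw [Real.norm_of_nonneg (by positivity)]
    refine (key h (by simpa using hh)).trans (le_of_eq (by ring))
  refine hO.trans_isLittleO ?_
  have : (fun h : ℂ => ‖h‖ ^ 2) =o[𝓝 0] fun h : ℂ => ‖h‖ ^ 1 :=
    (Asymptotics.isLittleO_pow_pow (𝕜 := ℝ) (one_lt_two)).comp_tendsto
      (by simpa using (continuous_norm (E := ℂ)).tendsto 0)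
  exact (this.congr_right fun h => pow_one ‖h‖).of_norm_right

theorem differentiable_expVec (α : ℂ) (hα : ‖α‖ < 1) : Differentiable ℂ (expVec α hα) :=
  fun β => (hasDerivAt_expVec α hα β).differentiableAt

/-! ### Inner products of Gaussian exponentials -/

theorem one_sub_mul_ne_zero {A B : ℂ} (hA : ‖A‖ < 1) (hB : ‖B‖ < 1) : 1 - A * B ≠ 0 := by
  intro h
  have h1 : ‖A * B‖ = 1 := by rw [← sub_eq_zero.1 h, norm_one]
  rw [norm_mul] at h1
  nlinarith [norm_nonneg A, norm_nonneg B]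

theorem re_one_add_half_pos {A B : ℂ} (hA : ‖A‖ < 1) (hB : ‖B‖ < 1) :
    0 < (1 + (A + B) / 2).re := by
  have h1 := Complex.abs_re_le_norm A
  have h2 := Complex.abs_re_le_norm B
  simp only [Complex.add_re, Complex.one_re, Complex.div_ofNat_re]
  linarith [(abs_le.1 h1).1, (abs_le.1 h2).1]

theorem normSq_lt_one {A : ℂ} (hA : ‖A‖ < 1) : A.re ^ 2 + A.im ^ 2 < 1 := by
  have h : ‖A‖ ^ 2 < 1 := by nlinarith [norm_nonneg A]
  rw [Complex.sq_norm, Complex.normSq_apply] at h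
  linarith

/-- This quotient is the coefficient of `-x²` left after the Gaussian integration in `y`; its
positivity makes the outer integral converge. -/
theorem re_schur_complement_pos {A B : ℂ} (hA : ‖A‖ < 1) (hB : ‖B‖ < 1) :
    0 < ((1 - A * B) / (1 + (A + B) / 2)).re := by
  have hpos := re_one_add_half_pos hA hB
  have hne : 0 < Complex.normSq (1 + (A + B) / 2) := by
    rw [Complex.normSq_pos]
    intro h
    rw [h] at hpos
    simp at hpos
  rw [Complex.div_re, ← add_div]
  refine div_pos ?_ hne
  have a1 := Complex.abs_re_le_norm A
  have b1 := Complex.abs_re_le_norm B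
  have a2 : 0 < 1 + A.re := by linarith [(abs_le.1 a1).1]
  have b2 : 0 < 1 + B.re := by linarith [(abs_le.1 b1).1]
  have a3 := normSq_lt_one hA
  have b3 := normSq_lt_one hB
  have e : (1 - A * B).re * (1 + (A + B) / 2).re + (1 - A * B).im * (1 + (A + B) / 2).im =
      (1 - (A.re ^ 2 + A.im ^ 2)) * (1 + B.re) / 2 + (1 - (B.re ^ 2 + B.im ^ 2)) * (1 + A.re) / 2
        + ((A.re - B.re) ^ 2 + (A.im + B.im) ^ 2) / 2 := by
    simp
    ring
  rw [e]
  have h1 := mul_pos (sub_pos.2 a3) b2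
  have h2 := mul_pos (sub_pos.2 b3) a2
  have h3 : 0 ≤ (A.re - B.re) ^ 2 + (A.im + B.im) ^ 2 := by positivity
  linarith

theorem sq_cpow_half (x : ℂ) : (x ^ (1 / 2 : ℂ)) ^ 2 = x := by
  rw [← Complex.cpow_nat_mul]
  norm_num

/-- The Gaussian integral of a quadratic exponential in `z` and `conj z`. -/
theorem exists_integral_integral_exp_quadratic {A B : ℂ} (hA : ‖A‖ < 1) (hB : ‖B‖ < 1) :
    ∃ C : ℂ, C ^ 2 * (1 - A * B) = 1 ∧ ∀ u v : ℂ,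
      ∫ x : ℝ, ∫ y : ℝ, (Real.pi : ℂ)⁻¹ * Complex.exp
        (A * (x + y * Complex.I) ^ 2 / 2 + u * (x + y * Complex.I) +
          (B * (x - y * Complex.I) ^ 2 / 2 + v * (x - y * Complex.I)) - x ^ 2 - y ^ 2) =
      C * Complex.exp ((A * v ^ 2 / 2 + B * u ^ 2 / 2 + u * v) / (1 - A * B)) := by
  -- `-P` is the coefficient of `y²` in the exponent.
  set P : ℂ := 1 + (A + B) / 2 with hP
  have hPre := re_one_add_half_pos hA hB
  have hSre := re_schur_complement_pos hA hB
  rw [← hP] at hPre hSre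
  have hP0 : P ≠ 0 := fun h => by rw [h] at hPre; simp at hPre
  have hAB := one_sub_mul_ne_zero hA hB
  have hpi : (Real.pi : ℂ) ≠ 0 := by exact_mod_cast Real.pi_ne_zero
  -- Only the square of this constant is recorded: a product of principal roots determines `(1 - A
  -- B) ^ (-1/2)` up to sign, and the sign is recovered later from positivity.
  refine ⟨(Real.pi : ℂ)⁻¹ * (Real.pi / -(-P)) ^ (1 / 2 : ℂ) *
    (Real.pi / -(-((1 - A * B) / P))) ^ (1 / 2 : ℂ), ?_, fun u v => ?_⟩
  · rw [mul_pow, mul_pow, sq_cpow_half, sq_cpow_half]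
    field_simp
  · have h1 : ∀ x : ℝ, ∫ y : ℝ, (Real.pi : ℂ)⁻¹ * Complex.exp
        (A * (x + y * Complex.I) ^ 2 / 2 + u * (x + y * Complex.I) +
          (B * (x - y * Complex.I) ^ 2 / 2 + v * (x - y * Complex.I)) - x ^ 2 - y ^ 2) =
        ((Real.pi : ℂ)⁻¹ * (Real.pi / -(-P)) ^ (1 / 2 : ℂ)) *
          Complex.exp (-((1 - A * B) / P) * x ^ 2 +
            (u + v - (A - B) * (u - v) / (2 * P)) * x + -(u - v) ^ 2 / (4 * P)) := by
      intro x
      rw [integral_const_mul, mul_assoc]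
      congr 1
      have := integral_cexp_quadratic (b := -P) (by simpa using hPre)
        (Complex.I * ((A - B) * x + (u - v)))
        ((A + B) / 2 * x ^ 2 - x ^ 2 + (u + v) * x)
      rw [show (fun y : ℝ => Complex.exp
        (A * (x + y * Complex.I) ^ 2 / 2 + u * (x + y * Complex.I) +
          (B * (x - y * Complex.I) ^ 2 / 2 + v * (x - y * Complex.I)) - x ^ 2 - y ^ 2)) =
          fun y : ℝ => Complex.exp (-P * (y : ℂ) ^ 2 +
            Complex.I * ((A - B) * x + (u - v)) * y +
            ((A + B) / 2 * x ^ 2 - x ^ 2 + (u + v) * x)) from ?_, this]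
      · congr 2
        rw [mul_pow, Complex.I_sq]
        field_simp
        rw [hP]
        ring
      · funext y
        congr 1
        rw [hP]
        linear_combination ((A + B) / 2 * y ^ 2) * Complex.I_sq
    simp_rw [h1]
    rw [integral_const_mul, integral_cexp_quadratic (by simpa using hSre), ← mul_assoc]
    congr 2
    field_simp
    rw [hP]
    ring

theorem integral_complex_eq_integral_integral {f : ℂ → ℂ} (hf : Integrable f) :
    ∫ z, f z = ∫ x : ℝ, ∫ y : ℝ, f (x + y * Complex.I) := by
  have h := Complex.volume_preserving_equiv_real_prod.symm
  have hi : Integrable (fun p : ℝ × ℝ => f (Complex.measurableEquivRealProd.symm p)) :=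
    (h.integrable_comp_emb Complex.measurableEquivRealProd.symm.measurableEmbedding).2 hf
  rw [← h.integral_comp Complex.measurableEquivRealProd.symm.measurableEmbedding,
    Measure.volume_eq_prod, integral_prod _ (by rwa [Measure.volume_eq_prod] at hi)]
  simp only [Complex.measurableEquivRealProd_symm_apply, Complex.mk_eq_add_mul_I]

/-- The inner products of the functions `exp (α z² / 2 + β z)`. -/
theorem exists_inner_expVec {α α' : ℂ} (hα : ‖α‖ < 1) (hα' : ‖α'‖ < 1) :
    ∃ C : ℂ, C ^ 2 * (1 - α * conj α') = 1 ∧ ∀ β β' : ℂ,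
      inner ℂ (expVec α' hα' β') (expVec α hα β) =
        C * Complex.exp ((α * conj β' ^ 2 / 2 + conj α' * β ^ 2 / 2 + β * conj β') /
          (1 - α * conj α')) := by
  obtain ⟨C, hC, h⟩ := exists_integral_integral_exp_quadratic hα
    (B := conj α') (by rwa [RCLike.norm_conj])
  refine ⟨C, hC, fun β β' => ?_⟩
  have hi := integrable_gaussian_iff.1 (integrable_mul_conj (expVec α' hα' β') (expVec α hα β))
  rw [← h, inner_def, integral_gaussian, integral_complex_eq_integral_integral hi]
  congr 1
  funext x
  congr 1
  funext y
  have hn : ‖(x + y * Complex.I : ℂ)‖ ^ 2 = x ^ 2 + y ^ 2 := by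
    rw [Complex.sq_norm, Complex.normSq_add_mul_I]
  rw [hn, Complex.real_smul, Complex.ofReal_mul, Complex.ofReal_inv, mul_assoc,
    Complex.ofReal_exp, expVec_apply, expVec_apply, ← Complex.exp_conj, ← Complex.exp_add,
    ← Complex.exp_add]
  congr 2
  simp [Complex.conj_ofNat]
  ring

/-! ### Mean value property and reproducing kernel -/

theorem measurePreserving_rotation_gaussian (a : Circle) :
    MeasurePreserving (rotation a) gaussian gaussian := by
  have h := (rotation a).measurePreserving
  refine ⟨h.measurable, ?_⟩
  ext s hs
  rw [Measure.map_apply h.measurable hs, gaussian, withDensity_apply _ (h.measurable hs),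
    withDensity_apply _ hs, ← h.setLIntegral_comp_preimage hs measurable_density]
  simp only [LinearIsometryEquiv.norm_map]

/-- The mean value property of entire functions for the Gaussian measure. -/
theorem integral_gaussian_of_differentiable {f : ℂ → ℂ} (hf : Differentiable ℂ f)
    (hi : Integrable f gaussian) : ∫ z, f z ∂gaussian = f 0 := by
  have hrot : ∀ θ : ℝ, ∫ z, f (rotation (Circle.exp θ) z) ∂gaussian = ∫ z, f z ∂gaussian :=
    fun θ => (measurePreserving_rotation_gaussian _).integral_comp
      (rotation (Circle.exp θ)).toHomeomorph.measurableEmbedding f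
  have hcont : Continuous fun p : ℝ × ℂ => f (rotation (Circle.exp p.1) p.2) := by
    simp only [rotation_apply, Circle.coe_exp]
    exact hf.continuous.comp (by fun_prop)
  have hint : Integrable (Function.uncurry fun (θ : ℝ) (z : ℂ) => f (rotation (Circle.exp θ) z))
      ((volume.restrict (Ioc 0 (2 * Real.pi))).prod gaussian) := by
    refine (integrable_prod_iff hcont.aestronglyMeasurable).2 ?_
    have hn : ∀ θ : ℝ, ∫ z, ‖f (rotation (Circle.exp θ) z)‖ ∂gaussian =
        ∫ z, ‖f z‖ ∂gaussian := fun θ =>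
      (measurePreserving_rotation_gaussian _).integral_comp
        (rotation (Circle.exp θ)).toHomeomorph.measurableEmbedding fun z => ‖f z‖
    refine ⟨Eventually.of_forall fun θ => ?_, ?_⟩
    · exact ((measurePreserving_rotation_gaussian (Circle.exp θ)).integrable_comp_emb
        (rotation (Circle.exp θ)).toHomeomorph.measurableEmbedding).2 hi
    · simp only [hn]
      exact integrable_const _
  -- Each circle centred at `0` has mean value `f 0`; rotation invariance and Fubini transfer this
  -- to the Gaussian integral.
  have hmean : ∀ z : ℂ, ∫ θ in Ioc 0 (2 * Real.pi), f (rotation (Circle.exp θ) z) =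
      (2 * Real.pi : ℝ) • f 0 := by
    intro z
    have h1 : Real.circleAverage (fun w => f (w * z)) 0 1 = f (0 * z) :=
      (Differentiable.diffContOnCl (by fun_prop)).circleAverage
    rw [Real.circleAverage_def, intervalIntegral.integral_of_le (by positivity), zero_mul] at h1
    rw [← h1, smul_smul, mul_inv_cancel₀ (by positivity), one_smul]
    simp [rotation_apply, circleMap]
  have h2 := integral_integral_swap hint
  simp only [hrot, hmean] at h2
  rw [integral_const, integral_const] at h2
  have h3 : (2 * Real.pi : ℝ) ≠ 0 := by positivity
  simp only [measureReal_restrict_apply_univ, Real.volume_real_Ioc, sub_zero,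
    probReal_univ, one_smul] at h2
  rw [max_eq_left (by positivity)] at h2
  exact smul_right_injective _ h3 h2

/-- The reproducing kernel of `F²`. -/
def kernelVec (w : ℂ) : FockSpace := expVec 0 (by simp) (conj w)

@[simp] theorem kernelVec_apply (w z : ℂ) : kernelVec w z = Complex.exp (conj w * z) := by
  simp [kernelVec]

/-- Translation by `w` turns the integrand into the centred Gaussian weight times the entire
function `f (u + w) exp (-conj w u)`, whose value at `u = 0` is `f w`. -/
theorem inner_kernelVec (w : ℂ) (f : FockSpace) : inner ℂ (kernelVec w) f = f w := by
  have hi := integrable_gaussian_iff.1 (integrable_mul_conj (kernelVec w) f)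
  have e : ∀ u : ℂ, (Real.pi⁻¹ * Real.exp (-‖u + w‖ ^ 2)) •
      (f (u + w) * conj (kernelVec w (u + w))) =
      (Real.pi⁻¹ * Real.exp (-‖u‖ ^ 2)) • (f (u + w) * Complex.exp (-(conj w * u))) := by
    intro u
    rw [kernelVec_apply, ← Complex.exp_conj, Complex.real_smul, Complex.real_smul,
      Complex.ofReal_mul, Complex.ofReal_mul, Complex.ofReal_exp, Complex.ofReal_exp,
      mul_assoc, mul_assoc, mul_left_comm (Complex.exp _) (f _), mul_left_comm (Complex.exp _) (f _),
      ← Complex.exp_add, ← Complex.exp_add]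
    congr 3
    push_cast
    rw [← Complex.mul_conj', ← Complex.mul_conj']
    simp
    ring
  rw [inner_def, integral_gaussian, ← integral_add_right_eq_self _ w]
  have hi' := hi.comp_add_right w
  simp only [e] at hi' ⊢
  rw [← integral_gaussian (fun u => f (u + w) * Complex.exp (-(conj w * u))),
    integral_gaussian_of_differentiable _ (integrable_gaussian_iff.2 hi')]
  · simp
  · have := f.differentiable
    fun_prop

theorem eq_zero_of_inner_kernelVec {f : FockSpace} (h : ∀ w, inner ℂ f (kernelVec w) = 0) :
    f = 0 := by
  refine FockSpace.ext fun w => ?_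
  rw [← inner_kernelVec, ← inner_conj_symm, h, map_zero, FockSpace.zero_apply]

/-! ### Density of the exponentials with fixed quadratic part -/

theorem exists_norm_sq_expVec {α : ℂ} (hα : ‖α‖ < 1) :
    ∃ C : ℝ, 0 ≤ C ∧ ∀ β : ℂ, ‖expVec α hα β‖ ^ 2 =
      C * Real.exp (((α * conj β ^ 2).re + ‖β‖ ^ 2) / (1 - ‖α‖ ^ 2)) := by
  obtain ⟨C, -, h⟩ := exists_inner_expVec hα hα
  refine ⟨‖C‖, norm_nonneg C, fun β => ?_⟩
  have h1 : ‖expVec α hα β‖ ^ 2 = ‖(inner ℂ (expVec α hα β) (expVec α hα β) : ℂ)‖ := by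
    rw [inner_self_eq_norm_sq_to_K]
    simp
  rw [h1, h, norm_mul, Complex.norm_exp]
  congr 2
  have e1 : 1 - α * conj α = ((1 - ‖α‖ ^ 2 : ℝ) : ℂ) := by
    push_cast
    rw [Complex.mul_conj']
  rw [e1, Complex.div_ofReal_re]
  congr 1
  rw [Complex.mul_conj']
  have e2 : conj α * β ^ 2 = conj (α * conj β ^ 2) := by simp
  rw [e2, ← Complex.ofReal_pow]
  simp only [Complex.add_re, Complex.div_ofNat_re, Complex.conj_re, Complex.ofReal_re]
  ring

/-- Along the direction `i γ` the term `γ² conj β²` contributes `-‖γ‖⁴ x²`, which offsets part of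
the growth `‖γ‖² x²` of `‖β‖²`. -/
theorem re_add_normSq_line_le (γ u : ℂ) (x : ℝ) :
    (γ ^ 2 * conj (u + Complex.I * γ * x) ^ 2).re + ‖u + Complex.I * γ * x‖ ^ 2 ≤
      (1 + ‖γ‖ ^ 2) * (‖u‖ ^ 2 + 2 * ‖γ‖ * ‖u‖ * |x|) +
        (‖γ‖ ^ 2 - ‖γ‖ ^ 4) * x ^ 2 := by
  have e1 : γ ^ 2 * conj (u + Complex.I * γ * x) ^ 2 =
      (γ * conj u) ^ 2 + -(2 * Complex.I * (γ * conj γ) * (γ * conj u) * x) +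
        ((-(‖γ‖ ^ 4 * x ^ 2) : ℝ) : ℂ) := by
    push_cast
    rw [show (‖γ‖ : ℂ) ^ 4 = ((‖γ‖ : ℂ) ^ 2) ^ 2 by ring, ← Complex.mul_conj']
    simp only [map_add, map_mul, Complex.conj_I, Complex.conj_ofReal]
    linear_combination (γ ^ 2 * conj γ ^ 2 * x ^ 2) * Complex.I_sq
  have h1 := Complex.re_le_norm ((γ * conj u) ^ 2)
  have h2 := Complex.re_le_norm (-(2 * Complex.I * (γ * conj γ) * (γ * conj u) * x))
  simp only [norm_pow, norm_mul, norm_neg, RCLike.norm_conj, Complex.norm_I, Complex.norm_real,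
    Real.norm_eq_abs, RCLike.norm_ofNat, mul_one] at h1 h2
  have h3 : ‖u + Complex.I * γ * x‖ ≤ ‖u‖ + ‖γ‖ * |x| := by
    refine (norm_add_le _ _).trans (le_of_eq ?_)
    simp
  have h4 : ‖u + Complex.I * γ * x‖ ^ 2 ≤ (‖u‖ + ‖γ‖ * |x|) ^ 2 :=
    pow_le_pow_left₀ (norm_nonneg _) h3 2
  rw [e1, Complex.add_re, Complex.add_re, Complex.ofReal_re]
  have h5 : |x| ^ 2 = x ^ 2 := sq_abs x
  have h6 : (‖u‖ + ‖γ‖ * |x|) ^ 2 = ‖u‖ ^ 2 + 2 * ‖γ‖ * ‖u‖ * |x| + ‖γ‖ ^ 2 * x ^ 2 := by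
    rw [← h5]
    ring
  linarith [h1, h2, h4, h6]

/-- After division by `1 - ‖γ‖⁴` the squared norm grows at quadratic rate `‖γ‖² / (1 + ‖γ‖²) ≤ 1/2`,
less than the rate `1` of the squared weight. -/
theorem integrable_gaussian_smul_expVec {γ : ℂ} (hγ : ‖γ ^ 2‖ < 1) (u : ℂ) :
    Integrable fun x : ℝ =>
      Real.exp (-x ^ 2 / 2) • expVec (γ ^ 2) hγ (u + Complex.I * γ * x) := by
  obtain ⟨C, hC, h⟩ := exists_norm_sq_expVec hγ
  set k : ℝ := 2 * ‖γ‖ * ‖u‖ / (1 - ‖γ‖ ^ 2) with hk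
  set k₀ : ℝ := ‖u‖ ^ 2 / (1 - ‖γ‖ ^ 2) with hk₀
  have ha : ‖γ‖ ^ 2 < 1 := by rwa [norm_pow] at hγ
  have ha' : 0 < 1 - ‖γ‖ ^ 2 := by linarith
  have hcont : Continuous fun x : ℝ =>
      Real.exp (-x ^ 2 / 2) • expVec (γ ^ 2) hγ (u + Complex.I * γ * x) :=
    (by fun_prop : Continuous fun x : ℝ => Real.exp (-x ^ 2 / 2)).smul
      ((differentiable_expVec _ hγ).continuous.comp (by fun_prop))
  -- For the squared norm, the exponents `-x² + x²/2 + x²/4` (the last from the linear term) leave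
  -- `-x²/4`, hence `1/8` for the norm.
  refine ((integrable_exp_neg_mul_sq (b := 1 / 8) (by norm_num)).const_mul
    (√(C * Real.exp (k₀ + k ^ 2)))).mono' hcont.aestronglyMeasurable
    (Eventually.of_forall fun x => ?_)
  refine le_of_sq_le_sq ?_ (by positivity)
  rw [norm_smul, mul_pow, mul_pow, Real.sq_sqrt (by positivity), h,
    Real.norm_of_nonneg (by positivity), ← Real.exp_nat_mul, ← Real.exp_nat_mul, mul_left_comm,
    mul_assoc C, ← Real.exp_add, ← Real.exp_add]
  refine mul_le_mul_of_nonneg_left (Real.exp_le_exp.2 ?_) hC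
  have h1 := re_add_normSq_line_le γ u x
  have h2 : ((γ ^ 2 * conj (u + Complex.I * γ * x) ^ 2).re + ‖u + Complex.I * γ * x‖ ^ 2) /
      (1 - ‖γ ^ 2‖ ^ 2) ≤ k₀ + k * |x| + x ^ 2 / 2 := by
    have e : 1 - ‖γ ^ 2‖ ^ 2 = (1 - ‖γ‖ ^ 2) * (1 + ‖γ‖ ^ 2) := by
      rw [norm_pow]
      ring
    rw [e, div_le_iff₀ (by positivity)]
    refine h1.trans ?_
    have e2 : (k₀ + k * |x| + x ^ 2 / 2) * ((1 - ‖γ‖ ^ 2) * (1 + ‖γ‖ ^ 2)) =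
        (1 + ‖γ‖ ^ 2) * (‖u‖ ^ 2 + 2 * ‖γ‖ * ‖u‖ * |x|) +
          x ^ 2 / 2 * ((1 - ‖γ‖ ^ 2) * (1 + ‖γ‖ ^ 2)) := by
      rw [hk, hk₀]
      field_simp
    rw [e2]
    have : 0 ≤ (1 - ‖γ‖ ^ 2) * (1 - ‖γ‖ ^ 2) * x ^ 2 := by positivity
    linarith
  have h3 : k * |x| ≤ k ^ 2 + x ^ 2 / 4 := by
    rw [← sq_abs x]
    nlinarith [sq_nonneg (k - |x| / 2)]
  push_cast
  linarith

/-- The functions `exp (α z² / 2 + β z)`, for fixed `α`, span a dense subspace of `F²`. -/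
theorem eq_zero_of_inner_expVec {α : ℂ} (hα : ‖α‖ < 1) {f : FockSpace}
    (hf : ∀ β, inner ℂ f (expVec α hα β) = 0) : f = 0 := by
  obtain ⟨γ, rfl⟩ : ∃ γ : ℂ, γ ^ 2 = α := ⟨_, sq_cpow_half α⟩
  refine eq_zero_of_inner_kernelVec fun w => ?_
  have hi := integrable_gaussian_smul_expVec hα (conj w)
  -- The Gaussian Fourier integral in `x` produces a multiple of `exp (-γ² z² / 2)`, cancelling the
  -- quadratic part and leaving a reproducing kernel.
  have hv : ∫ x : ℝ, Real.exp (-x ^ 2 / 2) • expVec (γ ^ 2) hα (conj w + Complex.I * γ * x) =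
      ((2 * Real.pi : ℂ) ^ (1 / 2 : ℂ)) • kernelVec w := by
    refine FockSpace.ext fun z => ?_
    rw [← inner_kernelVec, ← integral_inner hi, FockSpace.smul_apply, kernelVec_apply]
    have e : ∀ x : ℝ, inner ℂ (kernelVec z)
        (Real.exp (-x ^ 2 / 2) • expVec (γ ^ 2) hα (conj w + Complex.I * γ * x)) =
        Complex.exp ((-1 / 2 : ℂ) * x ^ 2 + Complex.I * γ * z * x +
          (γ ^ 2 * z ^ 2 / 2 + conj w * z)) := by
      intro x
      rw [← Complex.coe_smul, inner_smul_right, inner_kernelVec, expVec_apply, Complex.ofReal_exp,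
        ← Complex.exp_add]
      congr 1
      push_cast
      ring
    simp_rw [e]
    rw [integral_cexp_quadratic (by norm_num)]
    congr 2
    · ring
    · rw [mul_pow, mul_pow, Complex.I_sq]
      ring
  have h0 : inner ℂ f (∫ x : ℝ, Real.exp (-x ^ 2 / 2) •
      expVec (γ ^ 2) hα (conj w + Complex.I * γ * x)) = 0 := by
    rw [← integral_inner hi]
    refine integral_eq_zero_of_ae (Eventually.of_forall fun x => ?_)
    simp only
    rw [← Complex.coe_smul, inner_smul_right, hf, mul_zero]
    rfl
  rw [hv, inner_smul_right] at h0
  refine (mul_eq_zero.1 h0).resolve_left fun h => ?_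
  have h1 := sq_cpow_half (2 * Real.pi : ℂ)
  rw [h] at h1
  have : (Real.pi : ℂ) ≠ 0 := by exact_mod_cast Real.pi_ne_zero
  simp at h1

/-! ### Singular values from a complete system of eigenvectors -/

section Eigenvectors

variable {H : Type*} [NormedAddCommGroup H] [InnerProductSpace ℂ H] [CompleteSpace H]

/-- The eigenspaces of `|T|` for positive eigenvalues are those of `T* T`. -/
theorem eigenspace_abs_eq (T : H →L[ℂ] H) {σ : ℝ} (hσ : 0 < σ) :
    Module.End.eigenspace (CFC.abs T : H →L[ℂ] H).toLinearMap (σ : ℂ) =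
      Module.End.eigenspace (T.adjoint ∘L T).toLinearMap ((σ ^ 2 : ℝ) : ℂ) := by
  have hsq : ∀ x, (CFC.abs T : H →L[ℂ] H) ((CFC.abs T : H →L[ℂ] H) x) = T.adjoint (T x) := by
    intro x
    have h := CFC.abs_mul_abs T
    rw [ContinuousLinearMap.star_eq_adjoint] at h
    exact congrArg (fun S : H →L[ℂ] H => S x) h
  have hpos : (CFC.abs T : H →L[ℂ] H).IsPositive :=
    (ContinuousLinearMap.nonneg_iff_isPositive _).1 (CFC.abs_nonneg T)
  ext x
  rw [Module.End.mem_eigenspace_iff, Module.End.mem_eigenspace_iff]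
  simp only [ContinuousLinearMap.coe_coe, ContinuousLinearMap.comp_apply]
  constructor
  · intro h
    rw [← hsq, h, map_smul, h, smul_smul, sq]
    push_cast
    rfl
  · intro h
    -- Since `|T|² x = σ² x`, this `y` satisfies `|T| y = -σ y`, so positivity of `|T|` forces `y =
    -- 0`.
    set y := (CFC.abs T : H →L[ℂ] H) x - (σ : ℂ) • x with hy
    have h1 : (CFC.abs T : H →L[ℂ] H) y = -(σ : ℂ) • y := by
      rw [hy, map_sub, map_smul, hsq, h, sq]
      push_cast
      module
    have h2 := hpos.re_inner_nonneg_right y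
    rw [h1, inner_smul_right, inner_self_eq_norm_sq_to_K] at h2
    have h3 : ((-(σ : ℂ)) * ((‖y‖ : ℂ)) ^ 2).re = -(σ * ‖y‖ ^ 2) := by
      rw [← Complex.ofReal_pow, ← Complex.ofReal_neg, ← Complex.ofReal_mul, Complex.ofReal_re]
      ring
    have h4 : 0 ≤ -(σ * ‖y‖ ^ 2) := by
      rw [← h3]
      exact h2
    have h5 : ‖y‖ = 0 := by
      by_contra hne
      have : 0 < ‖y‖ := lt_of_le_of_ne (norm_nonneg y) (Ne.symm hne)
      have : 0 < σ * ‖y‖ ^ 2 := by positivity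
      linarith
    exact sub_eq_zero.1 (norm_eq_zero.1 h5)

variable {T : H →L[ℂ] H} {φ : ℕ → H} {ℓ : ℕ → ℝ}

theorem inner_eq_zero_of_eigenvectors {x y : H} {a b : ℝ} (hab : a ≠ b)
    (hx : T.adjoint (T x) = (a : ℂ) • x) (hy : T.adjoint (T y) = (b : ℂ) • y) :
    inner ℂ x y = 0 := by
  have h1 : inner ℂ (T.adjoint (T x)) y = inner ℂ x (T.adjoint (T y)) := by
    rw [ContinuousLinearMap.adjoint_inner_left, ContinuousLinearMap.adjoint_inner_right]
  rw [hx, hy, inner_smul_left, inner_smul_right, Complex.conj_ofReal] at h1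
  have h2 : ((a : ℂ) - b) * inner ℂ x y = 0 := by linear_combination h1
  refine (mul_eq_zero.1 h2).resolve_left fun h => hab ?_
  exact_mod_cast sub_eq_zero.1 h

/-- `T* T` has a complete sequence of eigenvectors `φ n`, with distinct eigenvalues `(ℓ n)²`. -/
structure IsSingularSystem (T : H →L[ℂ] H) (φ : ℕ → H) (ℓ : ℕ → ℝ) : Prop where
  pos : ∀ n, 0 < ℓ n
  injective : Function.Injective ℓ
  ne_zero : ∀ n, φ n ≠ 0
  eigen : ∀ n, T.adjoint (T (φ n)) = ((ℓ n ^ 2 : ℝ) : ℂ) • φ n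
  complete : ∀ x, (∀ n, inner ℂ (φ n) x = 0) → x = 0

namespace IsSingularSystem

theorem sq_ne (h : IsSingularSystem T φ ℓ) {σ : ℝ} (hσ : 0 < σ) {n : ℕ} (hn : ℓ n ≠ σ) :
    ℓ n ^ 2 ≠ σ ^ 2 := fun e =>
  hn ((sq_eq_sq₀ (h.pos n).le hσ.le).1 e)

theorem inner_eq_zero (h : IsSingularSystem T φ ℓ) {m n : ℕ} (hmn : m ≠ n) :
    inner ℂ (φ m) (φ n) = 0 :=
  inner_eq_zero_of_eigenvectors (h.sq_ne (h.pos n) (h.injective.ne hmn)) (h.eigen m) (h.eigen n)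

theorem singularMultiplicity_eq_one (h : IsSingularSystem T φ ℓ) (n : ℕ) :
    singularMultiplicity T (ℓ n) = 1 := by
  have e : Module.End.eigenspace (T.adjoint ∘L T).toLinearMap ((ℓ n ^ 2 : ℝ) : ℂ) =
      Submodule.span ℂ {φ n} := by
    refine le_antisymm (fun x hx => ?_) ?_
    · rw [Module.End.mem_eigenspace_iff] at hx
      have hx' : T.adjoint (T x) = ((ℓ n ^ 2 : ℝ) : ℂ) • x := hx
      have hne : inner ℂ (φ n) (φ n) ≠ 0 := inner_self_ne_zero.2 (h.ne_zero n)
      -- An eigenvector minus its projection onto `φ n` is orthogonal to the whole system.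
      have h0 := h.complete (x - (inner ℂ (φ n) x / inner ℂ (φ n) (φ n)) • φ n) fun m => by
        rw [inner_sub_right, inner_smul_right]
        by_cases hm : m = n
        · subst hm
          rw [div_mul_cancel₀ _ hne, sub_self]
        · rw [h.inner_eq_zero hm, inner_eq_zero_of_eigenvectors
            (h.sq_ne (h.pos n) (h.injective.ne hm)) (h.eigen m) hx', mul_zero, sub_zero]
      rw [sub_eq_zero.1 h0]
      exact Submodule.smul_mem _ _ (Submodule.mem_span_singleton_self _)
    · rw [Submodule.span_singleton_le_iff_mem, Module.End.mem_eigenspace_iff]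
      exact h.eigen n
  rw [singularMultiplicity, eigenspace_abs_eq T (h.pos n), e, finrank_span_singleton (h.ne_zero n)]

theorem singularMultiplicity_eq_zero (h : IsSingularSystem T φ ℓ) {σ : ℝ} (hσ : 0 < σ)
    (hne : ∀ n, ℓ n ≠ σ) : singularMultiplicity T σ = 0 := by
  have e : Module.End.eigenspace (T.adjoint ∘L T).toLinearMap ((σ ^ 2 : ℝ) : ℂ) = ⊥ := by
    rw [eq_bot_iff]
    intro x hx
    rw [Module.End.mem_eigenspace_iff] at hx
    exact h.complete x fun n => inner_eq_zero_of_eigenvectors (h.sq_ne hσ (hne n)) (h.eigen n) hx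
  rw [singularMultiplicity, eigenspace_abs_eq T hσ, e, finrank_bot]

theorem schattenSum_eq (h : IsSingularSystem T φ ℓ) (p : ℝ) :
    schattenSum p T = ∑' n, ENNReal.ofReal (ℓ n ^ p) := by
  have hinj : Function.Injective fun n => (⟨ℓ n, h.pos n⟩ : Ioi (0 : ℝ)) := fun m n hmn =>
    h.injective (congrArg Subtype.val hmn)
  rw [schattenSum, ← hinj.tsum_eq]
  · simp [h.singularMultiplicity_eq_one]
  · intro σ hσ
    by_contra hne
    refine hσ ?_
    simp only
    rw [h.singularMultiplicity_eq_zero σ.2 fun n hn => hne ⟨n, Subtype.ext hn⟩]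
    simp

theorem norm_apply (h : IsSingularSystem T φ ℓ) (n : ℕ) : ‖T (φ n)‖ = ℓ n * ‖φ n‖ := by
  refine (sq_eq_sq₀ (norm_nonneg _) (mul_nonneg (h.pos n).le (norm_nonneg _))).1 ?_
  have h1 : inner ℂ (φ n) (T.adjoint (T (φ n))) = inner ℂ (T (φ n)) (T (φ n)) :=
    ContinuousLinearMap.adjoint_inner_right _ _ _
  rw [h.eigen, inner_smul_right, inner_self_eq_norm_sq_to_K, inner_self_eq_norm_sq_to_K] at h1
  rw [mul_pow]
  simp only [Complex.coe_algebraMap] at h1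
  exact_mod_cast h1.symm

/-- If the singular values are summable, `T` is a norm convergent series of operators of
rank one. -/
theorem isCompactOperator (h : IsSingularSystem T φ ℓ) (hs : Summable ℓ) :
    IsCompactOperator T := by
  have hn : ∀ n, ‖φ n‖ ≠ 0 := fun n => norm_ne_zero_iff.2 (h.ne_zero n)
  set e : ℕ → H := fun n => ((‖φ n‖ : ℂ)⁻¹) • φ n with he
  have hort : Orthonormal ℂ e := by
    refine ⟨fun n => ?_, fun m n hmn => ?_⟩
    · simp only [he]
      rw [norm_smul, norm_inv, Complex.norm_real, norm_norm, inv_mul_cancel₀ (hn n)]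
    · simp only [he]
      rw [inner_smul_left, inner_smul_right, h.inner_eq_zero hmn]
      simp
  have hbot : (Submodule.span ℂ (Set.range e))ᗮ = ⊥ := by
    rw [eq_bot_iff]
    intro x hx
    rw [Submodule.mem_orthogonal] at hx
    refine h.complete x fun n => ?_
    have h1 := hx (e n) (Submodule.subset_span ⟨n, rfl⟩)
    simp only [he] at h1
    rw [inner_smul_left] at h1
    refine (mul_eq_zero.1 h1).resolve_left ?_
    simpa using h.ne_zero n
  set b := HilbertBasis.mkOfOrthogonalEqBot hort hbot with hb
  have hbe : ∀ n, b n = e n := fun n => by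
    rw [hb, HilbertBasis.coe_mkOfOrthogonalEqBot]
  -- These are the terms `⟨e n, ·⟩ T (e n)` of the expansion of `T` in the normalised basis; their
  -- norms are the singular values.
  set R : ℕ → H →L[ℂ] H := fun n => (innerSL ℂ (e n)).smulRight (T (e n)) with hR
  have hRn : ∀ n, ‖R n‖ = ℓ n := by
    intro n
    simp only [hR, ContinuousLinearMap.norm_smulRight_apply, innerSL_apply_norm, hort.1 n, one_mul]
    simp only [he]
    rw [map_smul, norm_smul, h.norm_apply, norm_inv, Complex.norm_real, norm_norm,
      mul_left_comm, inv_mul_cancel₀ (hn n), mul_one]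
  have hsum : Summable R := by
    refine Summable.of_norm ?_
    simpa only [hRn] using hs
  have hT : ∑' n, R n = T := by
    ext x
    have h1 : HasSum (fun n => R n x) ((∑' n, R n) x) :=
      hsum.hasSum.mapL (ContinuousLinearMap.apply ℂ H x)
    have h2 : HasSum (fun n => T (b.repr x n • b n)) (T x) := (b.hasSum_repr x).mapL T
    refine h1.unique ?_
    convert h2 using 2 with n
    rw [map_smul, HilbertBasis.repr_apply_apply, hbe]
    rfl
  have hcompact : ∀ n, IsCompactOperator (R n) := by
    intro n
    have h1 : IsCompactOperator (innerSL ℂ (e n)) := 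
      isCompactOperator_of_locallyCompactSpace_dom (innerSL ℂ (e n))
    exact h1.clm_comp ((ContinuousLinearMap.id ℂ ℂ).smulRight (T (e n)))
  have hlim := hsum.hasSum.tendsto_sum_nat
  rw [hT] at hlim
  refine isCompactOperator_of_tendsto hlim (Eventually.of_forall fun N => ?_)
  induction N with
  | zero => simpa using isCompactOperator_zero
  | succ N ih =>
    rw [Finset.sum_range_succ]
    exact ih.add (hcompact N)

end IsSingularSystem

end Eigenvectors

/-! ### The geometric series and its comparison with the bound -/

theorem rpow_geometric {m : ℝ} (hm : 1 < m) (p : ℝ) (n : ℕ) :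
    (m ^ (-((n : ℝ) + 1 / 2))) ^ p = m ^ (-p / 2) * (m ^ (-p)) ^ n := by
  have h0 : 0 < m := by linarith
  rw [← Real.rpow_natCast (m ^ (-p)), ← Real.rpow_mul h0.le, ← Real.rpow_mul h0.le,
    ← Real.rpow_add h0]
  congr 1
  ring

theorem summable_rpow_geometric {m : ℝ} (hm : 1 < m) :
    Summable fun n : ℕ => m ^ (-((n : ℝ) + 1 / 2)) := by
  have h := (summable_geometric_of_lt_one (by positivity)
    (Real.rpow_lt_one_of_one_lt_of_neg hm (by norm_num : -(1 : ℝ) < 0))).mul_left (m ^ (-1 / 2 : ℝ))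
  refine h.congr fun n => ?_
  rw [← rpow_geometric hm, Real.rpow_one]

theorem tsum_rpow_geometric {m : ℝ} (hm : 1 < m) {p : ℝ} (hp : 0 < p) :
    ∑' n : ℕ, ENNReal.ofReal ((m ^ (-((n : ℝ) + 1 / 2))) ^ p) =
      ENNReal.ofReal (m ^ (-p / 2) / (1 - m ^ (-p))) := by
  have h0 : 0 < m := by linarith
  have h1 : m ^ (-p) < 1 := Real.rpow_lt_one_of_one_lt_of_neg hm (by linarith)
  have hs : HasSum (fun n : ℕ => (m ^ (-((n : ℝ) + 1 / 2))) ^ p)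
      (m ^ (-p / 2) / (1 - m ^ (-p))) := by
    simp only [rpow_geometric hm, div_eq_mul_inv (m ^ (-p / 2))]
    exact (hasSum_geometric_of_lt_one (by positivity) h1).mul_left _
  rw [← ENNReal.ofReal_tsum_of_nonneg (fun n => by positivity) hs.summable, hs.tsum_eq]

section Estimates

variable {S D m p : ℝ}

/-- The relation `hmS` trades `D - 1` for `1 - m⁻²`, the quantity to which Bernoulli's inequality
applies. -/
theorem rpow_neg_mul_rpow (hm : 1 < m) (hmS : (D - 1) * m = S * (m ^ 2 - 1)) :
    m ^ (-p / 2) * (p * (D - 1) * (m ^ 2) ^ ((p - 2) / 4)) = p * S * (1 - m⁻¹ ^ 2) := by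
  have h0 : 0 < m := by linarith
  have e : m ^ (-p / 2) * (m ^ 2) ^ ((p - 2) / 4) = m⁻¹ := by
    rw [← Real.rpow_natCast m 2, ← Real.rpow_mul h0.le, ← Real.rpow_add h0, ← Real.rpow_neg_one]
    congr 1
    push_cast
    ring
  calc _ = p * (D - 1) * (m ^ (-p / 2) * (m ^ 2) ^ ((p - 2) / 4)) := by ring
    _ = p * ((D - 1) * m) * m⁻¹ ^ 2 := by
      rw [e]
      field_simp
    _ = _ := by
      rw [hmS]
      field_simp

theorem rpow_neg_eq (hm : 1 < m) : m ^ (-p) = (1 + (m⁻¹ ^ 2 - 1)) ^ (p / 2) := by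
  have h0 : 0 < m := by linarith
  rw [add_sub_cancel, ← Real.rpow_natCast, ← Real.rpow_mul (by positivity), Real.inv_rpow h0.le,
    Real.rpow_neg h0.le]
  congr 2
  push_cast
  ring

/-- Bernoulli with exponent `p / 2 ≤ 1` gives `1 - m⁻ᵖ ≥ (p / 2) (1 - m⁻²)`, and `m² ≤ D` is raised
to a nonpositive power. -/
theorem geometric_le (hS : 0 < S) (hD : 1 < D) (hm : 1 < m)
    (hmS : (D - 1) * m = S * (m ^ 2 - 1)) (hmD : m ^ 2 ≤ D) (hp : 0 < p) (hp2 : p ≤ 2) :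
    m ^ (-p / 2) / (1 - m ^ (-p)) ≤ 2 * S / (p * (D - 1) * D ^ ((p - 2) / 4)) := by
  have h0 : 0 < m := by linarith
  have h1 : m ^ (-p) < 1 := Real.rpow_lt_one_of_one_lt_of_neg hm (by linarith)
  have hD1 : 0 < D - 1 := by linarith
  have hD0 : 0 < D := by linarith
  have hb := rpow_one_add_le_one_add_mul_self (s := m⁻¹ ^ 2 - 1) (p := p / 2)
    (by linarith [sq_nonneg m⁻¹]) (by linarith) (by linarith)
  rw [← rpow_neg_eq hm] at hb
  have hd : D ^ ((p - 2) / 4) ≤ (m ^ 2) ^ ((p - 2) / 4) :=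
    Real.rpow_le_rpow_of_nonpos (by positivity) hmD (by linarith)
  rw [div_le_div_iff₀ (by linarith) (by positivity)]
  calc _ ≤ m ^ (-p / 2) * (p * (D - 1) * (m ^ 2) ^ ((p - 2) / 4)) := by gcongr
    _ = p * S * (1 - m⁻¹ ^ 2) := rpow_neg_mul_rpow hm hmS
    _ = 2 * S * (-(p / 2 * (m⁻¹ ^ 2 - 1))) := by ring
    _ ≤ _ := mul_le_mul_of_nonneg_left (by linarith) (by positivity)

/-- Now `p / 2 ≥ 1` and `(p - 2) / 4 ≥ 0`, so both inequalities used for `p ≤ 2` reverse. -/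
theorem le_geometric (hS : 0 < S) (hD : 1 < D) (hm : 1 < m)
    (hmS : (D - 1) * m = S * (m ^ 2 - 1)) (hmD : m ^ 2 ≤ D) (hp2 : 2 ≤ p) :
    2 * S / (p * (D - 1) * D ^ ((p - 2) / 4)) ≤ m ^ (-p / 2) / (1 - m ^ (-p)) := by
  have h0 : 0 < m := by linarith
  have h1 : m ^ (-p) < 1 := Real.rpow_lt_one_of_one_lt_of_neg hm (by linarith)
  have hD1 : 0 < D - 1 := by linarith
  have hD0 : 0 < D := by linarith
  have hp : 0 < p := by linarith
  have hb := one_add_mul_self_le_rpow_one_add (s := m⁻¹ ^ 2 - 1) (p := p / 2)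
    (by linarith [sq_nonneg m⁻¹]) (by linarith)
  rw [← rpow_neg_eq hm] at hb
  have hd : (m ^ 2) ^ ((p - 2) / 4) ≤ D ^ ((p - 2) / 4) :=
    Real.rpow_le_rpow (by positivity) hmD (by linarith)
  rw [div_le_div_iff₀ (by positivity) (by linarith)]
  calc _ ≤ 2 * S * (-(p / 2 * (m⁻¹ ^ 2 - 1))) :=
        mul_le_mul_of_nonneg_left (by linarith) (by positivity)
    _ = p * S * (1 - m⁻¹ ^ 2) := by ring
    _ = m ^ (-p / 2) * (p * (D - 1) * (m ^ 2) ^ ((p - 2) / 4)) := (rpow_neg_mul_rpow hm hmS).symm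
    _ ≤ _ := by gcongr

end Estimates

namespace IsSingularSystem

variable {H : Type*} [NormedAddCommGroup H] [InnerProductSpace ℂ H] [CompleteSpace H]
  {T : H →L[ℂ] H} {φ : ℕ → H} {m p : ℝ}

theorem schattenSum_geometric (h : IsSingularSystem T φ fun n => m ^ (-((n : ℝ) + 1 / 2)))
    (hm : 1 < m) (hp : 0 < p) :
    schattenSum p T = ENNReal.ofReal (m ^ (-p / 2) / (1 - m ^ (-p))) := by
  rw [h.schattenSum_eq, tsum_rpow_geometric hm hp]

theorem schattenNorm_rpow (h : IsSingularSystem T φ fun n => m ^ (-((n : ℝ) + 1 / 2)))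
    (hm : 1 < m) (hp : 0 < p) :
    schattenNorm p T ^ p = m ^ (-p / 2) / (1 - m ^ (-p)) := by
  have h0 : 0 < m := by linarith
  have h1 : m ^ (-p) < 1 := Real.rpow_lt_one_of_one_lt_of_neg hm (by linarith)
  rw [schattenNorm, ← Real.rpow_mul ENNReal.toReal_nonneg, one_div_mul_cancel hp.ne',
    Real.rpow_one, h.schattenSum_geometric hm hp, ENNReal.toReal_ofReal]
  exact div_nonneg (by positivity) (by linarith)

end IsSingularSystem

/-! ### Construction of the operator and its adjoint -/

section CanonicalOperator

variable {s t : ℂ}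

theorem norm_pos_of_lt (hst : ‖t‖ ^ 2 + 1 < ‖s‖ ^ 2) : 0 < ‖s‖ := by
  refine lt_of_le_of_ne (norm_nonneg s) fun h => ?_
  rw [← h] at hst
  nlinarith [sq_nonneg ‖t‖]

theorem ne_zero_of_lt (hst : ‖t‖ ^ 2 + 1 < ‖s‖ ^ 2) : s ≠ 0 :=
  norm_pos_iff.1 (norm_pos_of_lt hst)

theorem norm_div_lt_one (hst : ‖t‖ ^ 2 + 1 < ‖s‖ ^ 2) : ‖t / s‖ < 1 := by
  rw [norm_div, div_lt_one (norm_pos_of_lt hst)]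
  exact lt_of_pow_lt_pow_left₀ 2 (norm_nonneg s) (by linarith)

theorem norm_neg_div_conj_lt_one (hst : ‖t‖ ^ 2 + 1 < ‖s‖ ^ 2) : ‖-(t / conj s)‖ < 1 := by
  rw [norm_neg, norm_div, RCLike.norm_conj, ← norm_div]
  exact norm_div_lt_one hst

/-- The symmetric matrix with rows `(t, 1)` and `(1, -conj t)` of this quadratic form is `√(‖t‖² +
1)` times a unitary matrix. -/
theorem norm_quadratic_le (t z v : ℂ) :
    ‖t * z ^ 2 - conj t * v ^ 2 + 2 * z * v‖ ≤
      √(‖t‖ ^ 2 + 1) * (‖z‖ ^ 2 + ‖v‖ ^ 2) := by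
  set k : ℝ := √(‖t‖ ^ 2 + 1) with hk
  have hk0 : 0 < k := by positivity
  have hk2 : k ^ 2 = ‖t‖ ^ 2 + 1 := Real.sq_sqrt (by positivity)
  have e1 : ‖t * z + v‖ ^ 2 + ‖z - conj t * v‖ ^ 2 = k ^ 2 * (‖z‖ ^ 2 + ‖v‖ ^ 2) := by
    rw [hk2]
    simp only [Complex.sq_norm, Complex.normSq_apply, Complex.add_re, Complex.add_im,
      Complex.sub_re, Complex.sub_im, Complex.mul_re, Complex.mul_im, Complex.conj_re,
      Complex.conj_im]
    ring
  have e2 : t * z ^ 2 - conj t * v ^ 2 + 2 * z * v = z * (t * z + v) + v * (z - conj t * v) := by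
    ring
  have h1 : ‖t * z ^ 2 - conj t * v ^ 2 + 2 * z * v‖ ≤
      ‖z‖ * ‖t * z + v‖ + ‖v‖ * ‖z - conj t * v‖ := by
    rw [e2, ← norm_mul, ← norm_mul]
    exact norm_add_le _ _
  refine h1.trans (le_of_mul_le_mul_left ?_ hk0)
  nlinarith [sq_nonneg (k * ‖z‖ - ‖t * z + v‖), sq_nonneg (k * ‖v‖ - ‖z - conj t * v‖)]

theorem norm_canonicalKernel_le (hs : 0 < ‖s‖) (z w : ℂ) :
    ‖canonicalKernel s t z w‖ ≤ ‖1 / Complex.sqrt s‖ *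
      Real.exp (√(‖t‖ ^ 2 + 1) / ‖s‖ * ‖z‖ ^ 2 / 2) *
        Real.exp (√(‖t‖ ^ 2 + 1) / ‖s‖ * ‖w‖ ^ 2 / 2) := by
  rw [canonicalKernel, norm_mul, mul_assoc ‖_‖, ← Real.exp_add, Complex.norm_exp]
  refine mul_le_mul_of_nonneg_left (Real.exp_le_exp.2 ?_) (norm_nonneg _)
  refine (Complex.re_le_norm _).trans ?_
  have h := norm_quadratic_le t z (conj w)
  rw [RCLike.norm_conj] at h
  rw [norm_div, norm_mul, RCLike.norm_ofNat, map_mul, map_pow, div_le_iff₀ (by positivity)]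
  refine h.trans (le_of_eq ?_)
  field_simp

/-- The element `w ↦ conj K(z, w)` of `F²`. -/
def canonicalKernelVec (hst : ‖t‖ ^ 2 + 1 < ‖s‖ ^ 2) (z : ℂ) : FockSpace :=
  conj (1 / Complex.sqrt s * Complex.exp (t / s * z ^ 2 / 2)) •
    expVec (-(t / conj s)) (norm_neg_div_conj_lt_one hst) (conj (z / s))

theorem conj_canonicalKernelVec (hst : ‖t‖ ^ 2 + 1 < ‖s‖ ^ 2) (z w : ℂ) :
    conj (canonicalKernelVec hst z w) = canonicalKernel s t z w := by
  have hs := ne_zero_of_lt hst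
  rw [canonicalKernelVec, FockSpace.smul_apply, map_mul, Complex.conj_conj, expVec_apply,
    ← Complex.exp_conj, mul_assoc, ← Complex.exp_add, canonicalKernel]
  congr 2
  simp [Complex.conj_ofNat]
  field_simp
  ring

/-- This is the Gaussian growth rate of the kernel in each variable; the hypothesis says exactly
that it is below the critical rate `1`. -/
theorem sqrt_sq_add_one_div_lt_one (hst : ‖t‖ ^ 2 + 1 < ‖s‖ ^ 2) :
    √(‖t‖ ^ 2 + 1) / ‖s‖ < 1 := by
  rw [div_lt_one (norm_pos_of_lt hst)]
  exact (Real.sqrt_lt' (norm_pos_of_lt hst)).2 hst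

theorem norm_canonicalKernelVec_le (hst : ‖t‖ ^ 2 + 1 < ‖s‖ ^ 2) (z : ℂ) :
    ‖canonicalKernelVec hst z‖ ≤ ‖1 / Complex.sqrt s‖ *
      Real.exp (√(‖t‖ ^ 2 + 1) / ‖s‖ * ‖z‖ ^ 2 / 2) *
        growthConst (√(‖t‖ ^ 2 + 1) / ‖s‖) := by
  have hs := norm_pos_of_lt hst
  refine FockSpace.norm_le_of_growth _ (by positivity)
    (sqrt_sq_add_one_div_lt_one hst) fun w => ?_
  rw [← RCLike.norm_conj (canonicalKernelVec hst z w), conj_canonicalKernelVec]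
  exact norm_canonicalKernel_le hs z w

theorem norm_inner_canonicalKernelVec_le (hst : ‖t‖ ^ 2 + 1 < ‖s‖ ^ 2) (f : FockSpace) (z : ℂ) :
    ‖inner ℂ (canonicalKernelVec hst z) f‖ ≤
      (‖1 / Complex.sqrt s‖ * growthConst (√(‖t‖ ^ 2 + 1) / ‖s‖) * ‖f‖) *
        Real.exp (√(‖t‖ ^ 2 + 1) / ‖s‖ * ‖z‖ ^ 2 / 2) := by
  refine (norm_inner_le_norm _ _).trans ?_
  have h := mul_le_mul_of_nonneg_right (norm_canonicalKernelVec_le hst z) (norm_nonneg f)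
  refine h.trans (le_of_eq (by ring))

theorem inner_canonicalKernelVec (hst : ‖t‖ ^ 2 + 1 < ‖s‖ ^ 2) (f : FockSpace) (z : ℂ) :
    inner ℂ (canonicalKernelVec hst z) f =
      1 / Complex.sqrt s * Complex.exp (t / s * z ^ 2 / 2) *
        inner ℂ (expVec (-(t / conj s)) (norm_neg_div_conj_lt_one hst) (conj (z / s))) f := by
  rw [canonicalKernelVec, inner_smul_left, Complex.conj_conj]

/-- The parameter `conj (z / s)` is antiholomorphic in `z`, and the conjugate-linear slot of the
inner product conjugates it back. -/
theorem differentiable_inner_canonicalKernelVec (hst : ‖t‖ ^ 2 + 1 < ‖s‖ ^ 2) (f : FockSpace) :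
    Differentiable ℂ fun z => inner ℂ (canonicalKernelVec hst z) f := by
  simp only [inner_canonicalKernelVec]
  have h1 : Differentiable ℂ fun β => inner ℂ f
      (expVec (-(t / conj s)) (norm_neg_div_conj_lt_one hst) β) :=
    (innerSL ℂ f).differentiable.comp (differentiable_expVec _ _)
  have h2 : Differentiable ℂ fun z => inner ℂ
      (expVec (-(t / conj s)) (norm_neg_div_conj_lt_one hst) (conj z)) f := by
    intro z
    have h3 := (h1 (conj z)).conj_conj
    rw [Complex.conj_conj] at h3
    refine h3.congr_of_eventuallyEq (Eventually.of_forall fun w => ?_)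
    simp
  have h4 : Differentiable ℂ fun z => inner ℂ
      (expVec (-(t / conj s)) (norm_neg_div_conj_lt_one hst) (conj (z / s))) f :=
    h2.comp (by fun_prop : Differentiable ℂ fun z : ℂ => z / s)
  fun_prop

/-- The canonical integral operator `T^{(s,t)}` on `F²`. -/
def canonicalOperator (hst : ‖t‖ ^ 2 + 1 < ‖s‖ ^ 2) : FockSpace →L[ℂ] FockSpace :=
  LinearMap.mkContinuous
    { toFun f := FockSpace.mk (fun z => inner ℂ (canonicalKernelVec hst z) f)
        (differentiable_inner_canonicalKernelVec hst f)
        (memLp_of_growth (differentiable_inner_canonicalKernelVec hst f).continuous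
          (sqrt_sq_add_one_div_lt_one hst) (norm_inner_canonicalKernelVec_le hst f))
      map_add' f g := FockSpace.ext fun z => by
        simp only [FockSpace.mk_apply, FockSpace.add_apply, inner_add_right]
      map_smul' c f := FockSpace.ext fun z => by
        simp only [RingHom.id_apply, FockSpace.mk_apply, FockSpace.smul_apply, inner_smul_right] }
    (‖1 / Complex.sqrt s‖ * growthConst (√(‖t‖ ^ 2 + 1) / ‖s‖) *
      growthConst (√(‖t‖ ^ 2 + 1) / ‖s‖))
    fun f => by
      have hg := growthConst_nonneg (√(‖t‖ ^ 2 + 1) / ‖s‖)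
      refine (FockSpace.norm_le_of_growth _ (by positivity) (sqrt_sq_add_one_div_lt_one hst)
        (norm_inner_canonicalKernelVec_le hst f)).trans (le_of_eq (by ring))

theorem canonicalOperator_apply (hst : ‖t‖ ^ 2 + 1 < ‖s‖ ^ 2) (f : FockSpace) (z : ℂ) :
    canonicalOperator hst f z = inner ℂ (canonicalKernelVec hst z) f := rfl

theorem isCanonicalOperator_canonicalOperator (hst : ‖t‖ ^ 2 + 1 < ‖s‖ ^ 2) :
    IsCanonicalOperator s t (canonicalOperator hst) := by
  intro f z
  have h := integrable_mul_conj (canonicalKernelVec hst z) f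
  simp only [conj_canonicalKernelVec, mul_comm (f _)] at h
  refine ⟨h, ?_⟩
  rw [canonicalOperator_apply, inner_def]
  simp only [conj_canonicalKernelVec, mul_comm (f _)]

theorem canonicalOperator_kernelVec (hst : ‖t‖ ^ 2 + 1 < ‖s‖ ^ 2) (w : ℂ) :
    canonicalOperator hst (kernelVec w) =
      (1 / Complex.sqrt s * Complex.exp (-(conj (t * w ^ 2) / (2 * s)))) •
        expVec (t / s) (norm_div_lt_one hst) (conj w / s) := by
  have hs := ne_zero_of_lt hst
  refine FockSpace.ext fun z => ?_
  rw [canonicalOperator_apply, ← inner_conj_symm, inner_kernelVec, conj_canonicalKernelVec,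
    FockSpace.smul_apply, expVec_apply, mul_assoc, ← Complex.exp_add, canonicalKernel]
  congr 2
  field_simp
  ring

/-- `T* g (w) = ⟨kernelVec w, T* g⟩ = ⟨T (kernelVec w), g⟩` in the convention of `inner`, so the
image of a kernel suffices. -/
theorem adjoint_canonicalOperator_apply (hst : ‖t‖ ^ 2 + 1 < ‖s‖ ^ 2) (g : FockSpace) (w : ℂ) :
    (canonicalOperator hst).adjoint g w =
      conj (1 / Complex.sqrt s) * Complex.exp (-(t * w ^ 2 / (2 * conj s))) *
        inner ℂ (expVec (t / s) (norm_div_lt_one hst) (conj w / s)) g := by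
  rw [← inner_kernelVec, ContinuousLinearMap.adjoint_inner_right, canonicalOperator_kernelVec,
    inner_smul_left, map_mul, ← Complex.exp_conj]
  simp [Complex.conj_ofNat]

end CanonicalOperator

/-! ### Action of the operator and its adjoint on Gaussian exponentials -/

section ActionOnExponentials

variable {s t α α' : ℂ} {R : ℝ}

theorem norm_sq_one_div_sqrt (s : ℂ) : ‖1 / Complex.sqrt s‖ ^ 2 = 1 / ‖s‖ := by
  have h : Complex.sqrt s ^ 2 = s := by
    rw [Complex.sqrt, ← one_div]
    exact sq_cpow_half s
  rw [norm_div, div_pow, norm_one, one_pow, ← norm_pow, h]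

theorem ofReal_mul_eq (h : R * (R + 1 + ‖t‖ ^ 2) = ‖s‖ ^ 2 * (R + 1)) :
    (R : ℂ) * (R + 1 + t * conj t) = s * conj s * (R + 1) := by
  rw [Complex.mul_conj', Complex.mul_conj']
  exact_mod_cast h

/-- The quadratic equation for `R` is what simplifies the denominator of the inner product formula
to `R / |s|²`; it makes the chosen `α` and `α'` correspond under `T` and `T*`. -/
theorem one_sub_mul_eq_div (hs : s ≠ 0) (hR : 0 < R)
    (h : R * (R + 1 + ‖t‖ ^ 2) = ‖s‖ ^ 2 * (R + 1)) :
    1 - R / (R + 1) * t * conj t / (s * conj s) = R / (s * conj s) := by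
  have h1 := ofReal_mul_eq h
  have hs' : conj s ≠ 0 := (map_ne_zero _).2 hs
  have hR1 : (R + 1 : ℂ) ≠ 0 := by exact_mod_cast (by positivity : R + 1 ≠ 0)
  field_simp
  linear_combination -h1

theorem norm_sq_eq_of_sq_mul {C : ℂ} (hs : s ≠ 0) (hR : 0 < R)
    (hC : C ^ 2 * (R / (s * conj s)) = 1) : ‖C‖ ^ 2 = ‖s‖ ^ 2 / R := by
  have h1 := congrArg norm hC
  have hs' : 0 < ‖s‖ := norm_pos_iff.2 hs
  rw [norm_mul, norm_div, norm_mul, norm_pow, RCLike.norm_conj, Complex.norm_real,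
    Real.norm_of_nonneg hR.le, norm_one] at h1
  field_simp at h1 ⊢
  linarith

theorem exists_canonicalOperator_expVec (hst : ‖t‖ ^ 2 + 1 < ‖s‖ ^ 2) (hR : 0 < R)
    (h : R * (R + 1 + ‖t‖ ^ 2) = ‖s‖ ^ 2 * (R + 1)) (hα : ‖α‖ < 1) (hα' : ‖α'‖ < 1)
    (e : α = -(R / (R + 1) * t / conj s)) (e' : α' = R / (R + 1) * t / s) :
    ∃ c : ℂ, ‖c‖ ^ 2 = ‖s‖ / R ∧ ∀ β, canonicalOperator hst (expVec α hα β) =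
      (c * Complex.exp (-(conj t * conj s * β ^ 2 / (2 * R)))) •
        expVec α' hα' (conj s / R * β) := by
  have hs := ne_zero_of_lt hst
  have hs0 : ‖s‖ ≠ 0 := norm_ne_zero_iff.2 hs
  have hs' : conj s ≠ 0 := (map_ne_zero _).2 hs
  have hR0 : (R : ℂ) ≠ 0 := by exact_mod_cast hR.ne'
  have hR1 : (R + 1 : ℂ) ≠ 0 := by exact_mod_cast (by positivity : R + 1 ≠ 0)
  obtain ⟨C, hC, hCi⟩ := exists_inner_expVec hα (norm_neg_div_conj_lt_one hst)
  have h1 : 1 - α * conj (-(t / conj s)) = R / (s * conj s) := by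
    rw [← one_sub_mul_eq_div hs hR h, e]
    simp only [map_neg, map_div₀, Complex.conj_conj]
    field_simp
  rw [h1] at hC hCi
  refine ⟨1 / Complex.sqrt s * C, ?_, fun β => FockSpace.ext fun z => ?_⟩
  · rw [norm_mul, mul_pow, norm_sq_one_div_sqrt, norm_sq_eq_of_sq_mul hs hR hC]
    field_simp
  · rw [canonicalOperator_apply, inner_canonicalKernelVec, hCi, FockSpace.smul_apply, expVec_apply,
      e, e']
    simp only [mul_assoc, mul_left_comm (Complex.exp _) C, ← Complex.exp_add]
    congr 3
    simp only [map_neg, map_div₀, Complex.conj_conj]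
    field_simp
    ring

theorem exists_adjoint_canonicalOperator_expVec (hst : ‖t‖ ^ 2 + 1 < ‖s‖ ^ 2) (hR : 0 < R)
    (h : R * (R + 1 + ‖t‖ ^ 2) = ‖s‖ ^ 2 * (R + 1)) (hα : ‖α‖ < 1) (hα' : ‖α'‖ < 1)
    (e : α = -(R / (R + 1) * t / conj s)) (e' : α' = R / (R + 1) * t / s) :
    ∃ c : ℂ, ‖c‖ ^ 2 = ‖s‖ / R ∧ ∀ β, (canonicalOperator hst).adjoint (expVec α' hα' β) =
      (c * Complex.exp (conj t * s * β ^ 2 / (2 * R))) • expVec α hα (s / R * β) := by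
  have hs := ne_zero_of_lt hst
  have hs0 : ‖s‖ ≠ 0 := norm_ne_zero_iff.2 hs
  have hs' : conj s ≠ 0 := (map_ne_zero _).2 hs
  have hR0 : (R : ℂ) ≠ 0 := by exact_mod_cast hR.ne'
  have hR1 : (R + 1 : ℂ) ≠ 0 := by exact_mod_cast (by positivity : R + 1 ≠ 0)
  obtain ⟨C, hC, hCi⟩ := exists_inner_expVec hα' (norm_div_lt_one hst)
  have h1 : 1 - α' * conj (t / s) = R / (s * conj s) := by
    rw [← one_sub_mul_eq_div hs hR h, e']
    simp only [map_div₀]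
    field_simp
  rw [h1] at hC hCi
  refine ⟨conj (1 / Complex.sqrt s) * C, ?_, fun β => FockSpace.ext fun z => ?_⟩
  · rw [norm_mul, mul_pow, RCLike.norm_conj, norm_sq_one_div_sqrt, norm_sq_eq_of_sq_mul hs hR hC]
    field_simp
  · rw [adjoint_canonicalOperator_apply, hCi, FockSpace.smul_apply, expVec_apply, e, e']
    simp only [mul_assoc, mul_left_comm (Complex.exp _) C, ← Complex.exp_add]
    congr 3
    simp only [map_div₀, Complex.conj_conj]
    field_simp
    ring

end ActionOnExponentials

/-! ### The generating function of the eigenvectors -/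

section Spectrum

variable {s t : ℂ} {R : ℝ}

theorem iteratedDeriv_clm_comp {E F : Type*} [NormedAddCommGroup E] [NormedSpace ℂ E]
    [NormedAddCommGroup F] [NormedSpace ℂ F] (L : E →L[ℂ] F) {f : ℂ → E} {n : ℕ} {x : ℂ}
    (hf : ContDiffAt ℂ n f x) :
    iteratedDeriv n (fun z => L (f z)) x = L (iteratedDeriv n f x) := by
  rw [iteratedDeriv_eq_iteratedFDeriv, iteratedDeriv_eq_iteratedFDeriv]
  have h := L.iteratedFDeriv_comp_left hf le_rfl
  exact congrArg (fun M => M fun _ => (1 : ℂ)) h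

/-- The exponentials `exp (δ β²) • expVec α β` on which `T* T` acts by scaling `β`. -/
def eigenGen (s t : ℂ) (R : ℝ) (α : ℂ) (hα : ‖α‖ < 1) (β : ℂ) : FockSpace :=
  Complex.exp (conj t * conj s * R / (2 * (R ^ 2 + s * conj s)) * β ^ 2) • expVec α hα β

theorem differentiable_eigenGen {α : ℂ} (hα : ‖α‖ < 1) :
    Differentiable ℂ (eigenGen s t R α hα) := by
  have h1 : Differentiable ℂ fun β : ℂ =>
      Complex.exp (conj t * conj s * R / (2 * (R ^ 2 + s * conj s)) * β ^ 2) := by fun_prop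
  exact h1.smul (differentiable_expVec α hα)

theorem contDiff_eigenGen {α : ℂ} (hα : ‖α‖ < 1) {n : ℕ} :
    ContDiff ℂ n (eigenGen s t R α hα) :=
  (differentiable_eigenGen hα).contDiff

theorem sq_add_mul_conj_ne_zero (hR : 0 < R) (s : ℂ) : (R : ℂ) ^ 2 + s * conj s ≠ 0 := by
  rw [Complex.mul_conj']
  exact_mod_cast (by positivity : R ^ 2 + ‖s‖ ^ 2 ≠ 0)

theorem exists_adjoint_comp_eigenGen (hst : ‖t‖ ^ 2 + 1 < ‖s‖ ^ 2) (hR : 0 < R)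
    (h : R * (R + 1 + ‖t‖ ^ 2) = ‖s‖ ^ 2 * (R + 1)) {α : ℂ} (hα : ‖α‖ < 1)
    (e : α = -(R / (R + 1) * t / conj s)) :
    ∃ c : ℂ, ‖c‖ = ‖s‖ / R ∧ ∀ β,
      (canonicalOperator hst).adjoint (canonicalOperator hst (eigenGen s t R α hα β)) =
        c • eigenGen s t R α hα (s * conj s / R ^ 2 * β) := by
  have hR0 : (R : ℂ) ≠ 0 := by exact_mod_cast hR.ne'
  have hd := sq_add_mul_conj_ne_zero hR s
  have hα' : ‖(R / (R + 1) * t / s : ℂ)‖ < 1 := by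
    have : ‖(R / (R + 1) * t / s : ℂ)‖ = ‖α‖ := by
      rw [e]
      simp
    rwa [this]
  obtain ⟨c₁, hc₁, h1⟩ := exists_canonicalOperator_expVec hst hR h hα hα' e rfl
  obtain ⟨c₂, hc₂, h2⟩ := exists_adjoint_canonicalOperator_expVec hst hR h hα hα' e rfl
  refine ⟨c₁ * c₂, ?_, fun β => ?_⟩
  · rw [← sq_eq_sq₀ (norm_nonneg _) (by positivity), norm_mul, mul_pow, hc₁, hc₂, sq]
  · have hb : s / R * (conj s / R * β) = s * conj s / R ^ 2 * β := by
      field_simp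
    simp only [eigenGen, map_smul, h1, h2, smul_smul, hb]
    congr 1
    have hx : ∀ a b c d : ℂ, a + b + c = d → Complex.exp a * (c₁ * Complex.exp b *
        (c₂ * Complex.exp c)) = c₁ * c₂ * Complex.exp d := by
      intro a b c d hd
      rw [← hd, Complex.exp_add, Complex.exp_add]
      ring
    rw [mul_assoc (Complex.exp _)]
    -- With `q = |s|² / R²`, cancelling the scalars requires `δ (1 - q²) = conj t conj s (1 - q) /
    -- (2 R)`; this determines the coefficient `δ` in `eigenGen`.
    refine hx _ _ _ _ ?_
    generalize hD : (R : ℂ) ^ 2 + s * conj s = d at hd ⊢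
    field_simp
    linear_combination (conj t * conj s * β ^ 2 * (R ^ 2 - s * conj s)) * hD

/-- The same factor `exp (δ β²)` cancels the quadratic terms of the inner product. A pure
exponential with `k ≠ 0` has no vanishing Taylor coefficient, hence neither has `eigenGen`. -/
theorem exists_inner_eigenGen (hs : s ≠ 0) (hR : 0 < R)
    (h : R * (R + 1 + ‖t‖ ^ 2) = ‖s‖ ^ 2 * (R + 1)) {α : ℂ} (hα : ‖α‖ < 1)
    (e : α = -(R / (R + 1) * t / conj s)) :
    ∃ C k : ℂ, C ≠ 0 ∧ k ≠ 0 ∧ ∀ β,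
      inner ℂ (eigenGen s t R α hα 1) (eigenGen s t R α hα β) = C * Complex.exp (k * β) := by
  have hR0 : (R : ℂ) ≠ 0 := by exact_mod_cast hR.ne'
  have hR1 : (R + 1 : ℂ) ≠ 0 := by exact_mod_cast (by positivity : R + 1 ≠ 0)
  have hd := sq_add_mul_conj_ne_zero hR s
  have hs' : conj s ≠ 0 := (map_ne_zero _).2 hs
  obtain ⟨C, hC, hCi⟩ := exists_inner_expVec hα hα
  have h0 : 1 - α * conj α ≠ 0 := right_ne_zero_of_mul (by rw [hC]; exact one_ne_zero)
  have hα2 : 1 - α * conj α = (R ^ 2 + s * conj s) / (s * conj s * (R + 1)) := by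
    have h1 := ofReal_mul_eq h
    rw [e]
    simp only [map_neg, map_div₀, map_mul, map_add, Complex.conj_conj, Complex.conj_ofReal, map_one]
    field_simp
    linear_combination (-R : ℂ) * h1
  refine ⟨C, 1 / (1 - α * conj α), ?_, one_div_ne_zero h0, fun β => ?_⟩
  · rintro rfl
    simp at hC
  · rw [eigenGen, eigenGen, inner_smul_left, inner_smul_right, hCi, ← Complex.exp_conj,
      mul_left_comm (Complex.exp _) C, mul_left_comm (Complex.exp _) C, ← Complex.exp_add,
      ← Complex.exp_add]
    congr 2
    rw [hα2, e]
    simp only [map_neg, map_div₀, map_mul, map_add, map_pow, Complex.conj_conj,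
      Complex.conj_ofReal, map_one, Complex.conj_ofNat]
    rw [mul_comm (conj s) s]
    field_simp
    ring

end Spectrum

/-! ### The singular system of the operator -/

section SingularSystem

variable {s t : ℂ} {R : ℝ}

theorem exists_root (hst : ‖t‖ ^ 2 + 1 < ‖s‖ ^ 2) :
    ∃ R : ℝ, 0 < R ∧ R * (R + 1 + ‖t‖ ^ 2) = ‖s‖ ^ 2 * (R + 1) ∧ ‖s‖ < R ∧
      R ^ 2 ≤ ‖s‖ ^ 2 * (‖s‖ ^ 2 - ‖t‖ ^ 2) := by
  set D : ℝ := ‖s‖ ^ 2 - ‖t‖ ^ 2 with hD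
  have hD1 : 0 < D - 1 := by linarith
  have hs := norm_pos_of_lt hst
  set r : ℝ := √((D - 1) ^ 2 + 4 * ‖s‖ ^ 2) with hr
  have hr2 : r ^ 2 = (D - 1) ^ 2 + 4 * ‖s‖ ^ 2 := Real.sq_sqrt (by positivity)
  have hr0 : 0 < r := by positivity
  have hR : 0 < (D - 1 + r) / 2 := by positivity
  generalize hRe : (D - 1 + r) / 2 = R at hR
  have hq : R ^ 2 - (D - 1) * R = ‖s‖ ^ 2 := by
    rw [← hRe]
    linear_combination hr2 / 4
  have hRD : D ≤ R := by
    -- By the quadratic equation this product equals `‖s‖² - D = ‖t‖²`.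
    have h1 : 0 ≤ (R - D) * (R + 1) := by nlinarith [sq_nonneg ‖t‖]
    linarith [nonneg_of_mul_nonneg_left h1 (by linarith : 0 < R + 1)]
  refine ⟨R, hR, by rw [hD] at hq; linarith, ?_, ?_⟩
  · refine lt_of_pow_lt_pow_left₀ 2 hR.le ?_
    nlinarith [mul_pos hD1 hR]
  · rw [← hq]
    -- After substituting for `‖s‖²`, the difference of the two sides is `(D - 1) R (R - D)`.
    nlinarith [mul_nonneg (mul_nonneg hD1.le hR.le) (sub_nonneg.2 hRD)]

/-- The eigenvectors of `T* T`: the Taylor coefficients of `eigenGen`. -/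
def eigenVec (s t : ℂ) (R : ℝ) (α : ℂ) (hα : ‖α‖ < 1) (n : ℕ) : FockSpace :=
  iteratedDeriv n (eigenGen s t R α hα) 0

theorem eigenVec_ne_zero (hs : s ≠ 0) (hR : 0 < R)
    (h : R * (R + 1 + ‖t‖ ^ 2) = ‖s‖ ^ 2 * (R + 1)) {α : ℂ} (hα : ‖α‖ < 1)
    (e : α = -(R / (R + 1) * t / conj s)) (n : ℕ) : eigenVec s t R α hα n ≠ 0 := by
  obtain ⟨C, k, hC, hk, hi⟩ := exists_inner_eigenGen hs hR h hα e
  intro h0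
  have h1 := iteratedDeriv_clm_comp (innerSL ℂ (eigenGen s t R α hα 1)) (n := n) (x := 0)
    (contDiff_eigenGen hα (s := s) (t := t) (R := R)).contDiffAt
  rw [← eigenVec, h0, map_zero] at h1
  simp only [innerSL_apply_apply, hi] at h1
  rw [iteratedDeriv_const_mul C (by fun_prop), iteratedDeriv_cexp_const_mul] at h1
  simp [hC, hk] at h1

/-- The Taylor series of the entire map `eigenGen` converges everywhere, so `f` is orthogonal to all
its values and thus to every exponential with this `α`. -/
theorem eigenVec_complete {α : ℂ} (hα : ‖α‖ < 1) {f : FockSpace}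
    (hf : ∀ n, inner ℂ (eigenVec s t R α hα n) f = 0) : f = 0 := by
  refine eq_zero_of_inner_expVec hα fun β => ?_
  have h1 := (Complex.hasSum_taylorSeries_of_entire
    (differentiable_eigenGen hα (s := s) (t := t) (R := R)) 0 β).mapL (innerSL ℂ f)
  have h2 : ∀ n, innerSL ℂ f ((n.factorial : ℂ)⁻¹ • (β - 0) ^ n •
      iteratedDeriv n (eigenGen s t R α hα) 0) = 0 := by
    intro n
    rw [innerSL_apply_apply, inner_smul_right, inner_smul_right, ← eigenVec, ← inner_conj_symm,
      hf, map_zero, mul_zero, mul_zero]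
  simp only [h2] at h1
  have h3 := h1.unique hasSum_zero
  rw [innerSL_apply_apply, eigenGen, inner_smul_right] at h3
  exact (mul_eq_zero.1 h3).resolve_left (Complex.exp_ne_zero _)

theorem adjoint_comp_eigenVec (hst : ‖t‖ ^ 2 + 1 < ‖s‖ ^ 2) {α : ℂ} (hα : ‖α‖ < 1) {c : ℂ}
    (hc : ∀ β, (canonicalOperator hst).adjoint (canonicalOperator hst (eigenGen s t R α hα β)) =
        c • eigenGen s t R α hα (s * conj s / R ^ 2 * β)) (n : ℕ) :
    (canonicalOperator hst).adjoint (canonicalOperator hst (eigenVec s t R α hα n)) =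
      (c * (s * conj s / R ^ 2) ^ n) • eigenVec s t R α hα n := by
  have hcd := contDiff_eigenGen hα (s := s) (t := t) (R := R) (n := n)
  have h1 := iteratedDeriv_clm_comp ((canonicalOperator hst).adjoint ∘L canonicalOperator hst)
    (n := n) (x := 0) hcd.contDiffAt
  simp only [ContinuousLinearMap.comp_apply, hc] at h1
  have h2 := congrFun (iteratedDeriv_comp_const_smul hcd (s * conj s / R ^ 2 : ℂ)) 0
  simp only [mul_zero] at h2
  rw [eigenVec, ← h1, iteratedDeriv_fun_const_smul_field, h2, smul_smul]

/-- Eigenvalues of `T* T` are nonnegative; this fixes the phase of `c`, of which only the modulus is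
known from the Gaussian integrals. -/
theorem eq_norm_of_adjoint_comp {H : Type*} [NormedAddCommGroup H] [InnerProductSpace ℂ H]
    [CompleteSpace H] {T : H →L[ℂ] H} {x : H} (hx : x ≠ 0) {c : ℂ}
    (h : T.adjoint (T x) = c • x) : c = (‖c‖ : ℂ) := by
  have h1 : inner ℂ x (T.adjoint (T x)) = inner ℂ (T x) (T x) :=
    ContinuousLinearMap.adjoint_inner_right _ _ _
  rw [h, inner_smul_right, inner_self_eq_norm_sq_to_K, inner_self_eq_norm_sq_to_K] at h1
  simp only [Complex.coe_algebraMap] at h1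
  have hx' : (‖x‖ : ℂ) ≠ 0 := by exact_mod_cast norm_ne_zero_iff.2 hx
  have h2 : c = ((‖T x‖ ^ 2 / ‖x‖ ^ 2 : ℝ) : ℂ) := by
    push_cast
    rw [eq_div_iff (pow_ne_zero 2 hx'), h1]
  rw [h2, Complex.norm_real, Real.norm_of_nonneg (by positivity)]

theorem exists_isSingularSystem (hst : ‖t‖ ^ 2 + 1 < ‖s‖ ^ 2)
    (h : R * (R + 1 + ‖t‖ ^ 2) = ‖s‖ ^ 2 * (R + 1)) (hsR : ‖s‖ < R) :
    ∃ φ, IsSingularSystem (canonicalOperator hst) φ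
      fun n => (R / ‖s‖) ^ (-((n : ℝ) + 1 / 2)) := by
  have hs := norm_pos_of_lt hst
  have hR : 0 < R := hs.trans hsR
  have hm : 1 < R / ‖s‖ := (one_lt_div hs).2 hsR
  have hm0 : 0 < R / ‖s‖ := by linarith
  obtain ⟨α, e⟩ : ∃ α : ℂ, α = -(R / (R + 1) * t / conj s) := ⟨_, rfl⟩
  have hα : ‖α‖ < 1 := by
    have h1 : ‖(R + 1 : ℂ)‖ = R + 1 := by
      rw [← Complex.ofReal_one, ← Complex.ofReal_add, Complex.norm_real,
        Real.norm_of_nonneg (by positivity)]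
    rw [e, norm_neg, mul_div_assoc, norm_mul, norm_div, norm_div, RCLike.norm_conj, h1,
      Complex.norm_real, Real.norm_of_nonneg hR.le, ← norm_div]
    have h2 : R / (R + 1) ≤ 1 := (div_le_one (by positivity)).2 (by linarith)
    exact (mul_le_of_le_one_left (norm_nonneg _) h2).trans_lt (norm_div_lt_one hst)
  obtain ⟨c, hc, hG⟩ := exists_adjoint_comp_eigenGen hst hR h hα e
  have hne := eigenVec_ne_zero (ne_zero_of_lt hst) hR h hα e
  have heig := adjoint_comp_eigenVec hst hα hG
  have hc' : c = ((‖s‖ / R : ℝ) : ℂ) := by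
    have h0 := heig 0
    rw [pow_zero, mul_one] at h0
    rw [eq_norm_of_adjoint_comp (hne 0) h0, hc]
  refine ⟨eigenVec s t R α hα, fun n => by positivity, fun a b hab => ?_, hne, fun n => ?_,
    fun x hx => eigenVec_complete hα hx⟩
  · have := (Real.rpow_right_inj hm0 hm.ne').1 hab
    have h1 : (a : ℝ) = b := by linarith
    exact_mod_cast h1
  · rw [heig n]
    congr 1
    -- The half in the exponent comes from the factor `c = ‖s‖ / R`, the eigenvalue for `n = 0`.
    have h1 : ((R / ‖s‖) ^ (-((n : ℝ) + 1 / 2))) ^ 2 = ‖s‖ / R * (‖s‖ ^ 2 / R ^ 2) ^ n := by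
      rw [← Real.rpow_natCast _ 2, rpow_geometric hm, ← inv_div R ‖s‖, ← div_pow,
        ← inv_div R ‖s‖, inv_pow, ← Real.rpow_neg_one, ← Real.rpow_natCast (R / ‖s‖) 2,
        ← Real.rpow_neg hm0.le]
      norm_num
    rw [h1, hc', Complex.mul_conj']
    push_cast
    rfl

end SingularSystem

end Fock

end

theorem mainTheorem3 (s t : ℂ) (hst : ‖t‖ ^ 2 + 1 < ‖s‖ ^ 2) :
    ∃ T : Fock.FockSpace →L[ℂ] Fock.FockSpace,
      Fock.IsCanonicalOperator s t T ∧
      IsCompactOperator T ∧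
      (∀ p : ℝ, 0 < p → Fock.MemSchatten p T) ∧
      (∀ p : ℝ, 0 < p → p ≤ 2 →
        Fock.schattenNorm p T ^ p ≤
          2 * ‖s‖ / (p * (‖s‖ ^ 2 - ‖t‖ ^ 2 - 1) *
            (‖s‖ ^ 2 - ‖t‖ ^ 2) ^ ((p - 2) / 4))) ∧
      (∀ p : ℝ, 2 ≤ p →
        2 * ‖s‖ / (p * (‖s‖ ^ 2 - ‖t‖ ^ 2 - 1) *
            (‖s‖ ^ 2 - ‖t‖ ^ 2) ^ ((p - 2) / 4)) ≤
          Fock.schattenNorm p T ^ p) := by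
  obtain ⟨R, hR, h, hsR, hRD⟩ := Fock.exists_root hst
  obtain ⟨φ, hφ⟩ := Fock.exists_isSingularSystem hst h hsR
  have hs := Fock.norm_pos_of_lt hst
  have hm : 1 < R / ‖s‖ := (one_lt_div hs).2 hsR
  have hD : 1 < ‖s‖ ^ 2 - ‖t‖ ^ 2 := by linarith
  have hmS : (‖s‖ ^ 2 - ‖t‖ ^ 2 - 1) * (R / ‖s‖) = ‖s‖ * ((R / ‖s‖) ^ 2 - 1) := by
    field_simp
    linarith
  have hmD : (R / ‖s‖) ^ 2 ≤ ‖s‖ ^ 2 - ‖t‖ ^ 2 := by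
    rw [div_pow, div_le_iff₀ (by positivity)]
    linarith
  have hcompact := hφ.isCompactOperator (Fock.summable_rpow_geometric hm)
  refine ⟨Fock.canonicalOperator hst, Fock.isCanonicalOperator_canonicalOperator hst, hcompact,
    fun p hp => ⟨hcompact, ?_⟩, fun p hp hp2 => ?_, fun p hp2 => ?_⟩
  · rw [hφ.schattenSum_geometric hm hp]
    exact ENNReal.ofReal_lt_top
  · rw [hφ.schattenNorm_rpow hm hp]
    exact Fock.geometric_le hs hD hm hmS hmD hp hp2
  · rw [hφ.schattenNorm_rpow hm (by linarith)]
    exact Fock.le_geometric hs hD hm hmS hmD hp2
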